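/- Theorem (Tóth's representation of the spin-$\frac12$ Heisenberg ferromagnet). Let $\Lambda=(\mathcal V,\mathcal E)$ be a finite simple graph, $\beta>0$ and $h\in\mathbb R$. On $\bigotimes_{x\in\mathcal V}\mathbb C^2$ let $S_x^{(i)}=S^{(i)}\otimes\mathrm{Id}_{\mathcal V\setminus\{x\}}$, where $$S^{(1)}=\tfrac12\begin{pmatrix}0&1\\1&0\end{pmatrix},\quad S^{(2)}=\tfrac12\begin{pmatrix}0&-\mathrm i\\ \mathrm i&0\end{pmatrix},\quad S^{(3)}=\tfrac12\begin{pmatrix}1&0\\0&-1\end{pmatrix},$$ and let $$H_{\Lambda,h}=-\sum_{\{x,y\}\in\mathcal E}\sum_{i=1}^3S_x^{(i)}S_y^{(i)}-h\sum_{x\in\mathcal V}S_x^{(3)},\qquad Z_\Lambda(\beta,h)=\operatorname{Tr}e^{-\beta H_{\Lambda,h}},\qquad \langle A\rangle_{\Lambda,\beta,h}=\frac{\operatorname{Tr}A\,e^{-\beta H_{\Lambda,h}}}{Z_\Lambda(\beta,h)}.$$ Let $\rho$ be the law (a probability measure) of the Poisson edge process: independent Poisson processes of unit intensity on $[0,\beta]$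 attached to the edges. That is, a realization is a finite sequence $\omega=((e_1,t_1),\dots,(e_k,t_k))$ of "bridges"; $k$ is Poisson with mean $\beta|\mathcal E|$ and, given $k$, the times are uniformly distributed in $\{0<t_1<\dots<t_k<\beta\}$ and the edges are independent and uniform in $\mathcal E$, independently of the times. A cycle of $\omega$ is a closed trajectory $\gamma:[0,L]\to\mathcal V\times[0,\beta]_{\rm per}$, $\gamma(\tau)=(x(\tau),t(\tau))$, where $[0,\beta]_{\rm per}$ is the circle of length $\beta$: $t$ runs at unit speed, and $x$ is left-continuous and piecewise constant and jumps exactly when the trajectory meets a bridge $(e,t(\tau))$ of $\omega$ with $x(\tau)\in e$, in which case it jumps to the other endpoint of $e$. Here $L=L(\gamma)$, the length of the cycle, is the smallest positive number with $\gamma(L)=\gamma(0)$. Cycles with the same support are identified. Let $\mathcal C(\omega)$ be the set of cycles and let $\gamma_x\in\mathcal C(\omega)$ be the cycle that contains $(x,0)$ (for $\rho$-almost every $\omega$ the cycles partition $\mathcal V\times[0,\beta]_{\rm per}$). Then, for all $x,y\in\mathcal V$, the integrals below converge absolutely and $$Z_\Lambda(2\beta,h)=e^{\frac\beta2|\mathcal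 E|}\int\rho(d\omega)\prod_{\gamma\in\mathcal C(\omega)}2\cosh(hL(\gamma)),$$ $$\operatorname{Tr}S_x^{(3)}e^{-2\beta H_{\Lambda,h}}=\tfrac12e^{\frac\beta2|\mathcal E|}\int\rho(d\omega)\,\tanh(hL(\gamma_x))\prod_{\gamma\in\mathcal C(\omega)}2\cosh(hL(\gamma)),$$ $$\operatorname{Tr}S_x^{(3)}S_y^{(3)}e^{-2\beta H_{\Lambda,h}}=\tfrac14e^{\frac\beta2|\mathcal E|}\int\rho(d\omega)\prod_{\gamma\in\mathcal C(\omega)}2\cosh(hL(\gamma))\times\begin{cases}1&\text{if }\gamma_x=\gamma_y,\\ \tanh(hL(\gamma_x))\tanh(hL(\gamma_y))&\text{if }\gamma_x\ne\gamma_y.\end{cases}$$ Moreover, the measure $\mathbb P^{\rm cycles}_{\Lambda,\beta,0}$ obtained by normalizing $2^{|\mathcal C(\omega)|}\rho(d\omega)$ is a probability measure, and for all $x,y\in\mathcal V$ $$\langle S_x^{(3)}S_y^{(3)}\rangle_{\Lambda,2\beta,0}=\tfrac14\,\mathbb P^{\rm cycles}_{\Lambda,\beta,0}(\gamma_x=\gamma_y).$$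 -/

import Mathlib

open MeasureTheory ProbabilityTheory Filter Topology

noncomputable section

namespace HeisenbergCycles

section Spins

variable {V : Type*} [Fintype V] [DecidableEq V]

/-- The spin-1/2 matrices `S⁽¹⁾, S⁽²⁾, S⁽³⁾`, indexed by `0, 1, 2`, in the basis `|1/2⟩, |-1/2⟩` of
`ℂ²`, which is indexed by `0, 1`. -/
def spinMatrix : Fin 3 → Matrix (Fin 2) (Fin 2) ℂ :=
  ![(1 / 2 : ℂ) • !![0, 1; 1, 0],
    (1 / 2 : ℂ) • !![0, -Complex.I; Complex.I, 0],
    (1 / 2 : ℂ) • !![1, 0; 0, -1]]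

/-- Operators on `⨂_{x ∈ V} ℂ²`, written as matrices in the orthonormal product basis
`|s⟩ = ⨂_x |s_x⟩`, which is indexed by the spin configurations `s : V → Fin 2`. -/
abbrev SpinOp (V : Type*) : Type _ := Matrix (V → Fin 2) (V → Fin 2) ℂ

/-- The operator `A ⊗ Id_{V ∖ {x}}`. -/
def siteOp (x : V) (A : Matrix (Fin 2) (Fin 2) ℂ) : SpinOp V :=
  Matrix.of fun s s' =>
    A (s x) (s' x) * ∏ y ∈ Finset.univ.erase x, (1 : Matrix (Fin 2) (Fin 2) ℂ) (s y) (s' y)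

/-- The spin operator `S_x⁽ⁱ⁾`. -/
def spinOp (i : Fin 3) (x : V) : SpinOp V := siteOp x (spinMatrix i)

/-- `S_x · S_y = ∑ᵢ S_x⁽ⁱ⁾ S_y⁽ⁱ⁾`. -/
def spinDot (x y : V) : SpinOp V := ∑ i, spinOp i x * spinOp i y

theorem siteOp_apply (x : V) (A : Matrix (Fin 2) (Fin 2) ℂ) (s s' : V → Fin 2) :
    siteOp x A s s' = if Function.update s x (s' x) = s' then A (s x) (s' x) else 0 := by
  unfold siteOp
  simp only [Matrix.of_apply, Matrix.one_apply]
  split_ifs with hs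
  · rw [Finset.prod_eq_one, mul_one]
    intro y hy
    rw [if_pos]
    rw [← hs, Function.update_of_ne (Finset.ne_of_mem_erase hy)]
  · have : ∃ y, y ≠ x ∧ s y ≠ s' y := by
      by_contra! hc
      apply hs
      funext y
      by_cases hy : y = x
      · subst hy; simp
      · rw [Function.update_of_ne hy, hc y hy]
    obtain ⟨y, hy, hne⟩ := this
    rw [Finset.prod_eq_zero (i := y) (by simp [hy]) (by simp [hne]), mul_zero]

theorem siteOp_mul_apply (x : V) (A : Matrix (Fin 2) (Fin 2) ℂ) (M : SpinOp V)
    (s s' : V → Fin 2) :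
    (siteOp x A * M) s s' = ∑ a, A (s x) a * M (Function.update s x a) s' := by
  rw [Matrix.mul_apply]
  simp only [siteOp_apply]
  rw [← Finset.sum_subset (Finset.subset_univ
    (Finset.univ.image fun a : Fin 2 => Function.update s x a))]
  · rw [Finset.sum_image]
    · simp
    · intro a _ b _ hab
      simpa using congrFun hab x
  · intro t _ ht
    rw [if_neg, zero_mul]
    intro h
    exact ht (Finset.mem_image.2 ⟨t x, Finset.mem_univ _, h⟩)

theorem siteOp_mul_siteOp_apply {x y : V} (hxy : x ≠ y) (A B : Matrix (Fin 2) (Fin 2) ℂ)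
    (s s' : V → Fin 2) :
    (siteOp x A * siteOp y B) s s' =
      if Function.update (Function.update s x (s' x)) y (s' y) = s' then
        A (s x) (s' x) * B (s y) (s' y) else 0 := by
  rw [siteOp_mul_apply, Finset.sum_eq_single (s' x)]
  · rw [siteOp_apply, Function.update_of_ne hxy.symm]
    split_ifs <;> simp
  · intro a _ ha
    rw [siteOp_apply, if_neg, mul_zero]
    intro h
    have := congrFun h x
    rw [Function.update_of_ne hxy, Function.update_self] at this
    exact ha this
  · simp

theorem siteOp_comm {x y : V} (hxy : x ≠ y) (A B : Matrix (Fin 2) (Fin 2) ℂ) :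
    siteOp x A * siteOp y B = siteOp y B * siteOp x A := by
  ext s s'
  rw [siteOp_mul_siteOp_apply hxy, siteOp_mul_siteOp_apply hxy.symm,
    Function.update_comm hxy, mul_comm]

theorem spinDot_comm (x y : V) : spinDot x y = spinDot y x := by
  by_cases h : x = y
  · rw [h]
  · exact Finset.sum_congr rfl fun i _ => siteOp_comm h _ _

/-- `S_x · S_y` as a function of the unordered pair `{x, y}`. -/
def edgeDot (e : Sym2 V) : SpinOp V := Sym2.lift ⟨spinDot, spinDot_comm⟩ e

/-- The ferromagnetic Heisenberg Hamiltonian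
`-∑_{{x,y} ∈ E} S_x · S_y - h ∑_{x ∈ V} S_x⁽³⁾` on the graph `G`. -/
def hamiltonian (G : SimpleGraph V) [DecidableRel G.Adj] (h : ℝ) : SpinOp V :=
  -(∑ e ∈ G.edgeFinset, edgeDot e) - (h : ℂ) • ∑ x, spinOp 2 x

/-- The unnormalized expectation `Tr (A e^{-β H})`. -/
def gibbsTrace (G : SimpleGraph V) [DecidableRel G.Adj] (β h : ℝ) (A : SpinOp V) : ℂ :=
  (A * NormedSpace.exp (-(β : ℂ) • hamiltonian G h)).trace

/-- The partition function `Z(β, h) = Tr e^{-β H}`. -/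
def partitionFunction (G : SimpleGraph V) [DecidableRel G.Adj] (β h : ℝ) : ℂ :=
  (NormedSpace.exp (-(β : ℂ) • hamiltonian G h)).trace

/-- The Gibbs state `⟨A⟩ = Tr (A e^{-β H}) / Tr e^{-β H}`. -/
def gibbsState (G : SimpleGraph V) [DecidableRel G.Adj] (β h : ℝ) (A : SpinOp V) : ℂ :=
  (partitionFunction G β h)⁻¹ * gibbsTrace G β h A

end Spins

section Cycles

variable {V : Type*} {β : ℝ}

/-- `Jumps B t x y`: a particle at the vertex `x` at time `t` continues at the vertex `y`. If a
bridge of `B` at time `t` has the endpoint `x`, then `y` is its other endpoint; otherwise `y = x`. -/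
def Jumps (B : Set (Sym2 V × AddCircle β)) (t : AddCircle β) (x y : V) : Prop :=
  (s(x, y), t) ∈ B ∨ (y = x ∧ ∀ e, x ∈ e → (e, t) ∉ B)

/-- Trajectories on `V × [0, β]_per` in the configuration `B` of bridges: time runs at unit speed,
the vertex is a left-continuous, piecewise constant function that jumps exactly at the bridges. -/
structure IsTrajectory (B : Set (Sym2 V × AddCircle β)) (γ : ℝ → V × AddCircle β) : Prop where
  time : ∀ τ : ℝ, (γ τ).2 = (γ 0).2 + (τ : AddCircle β)
  left : ∀ τ : ℝ, ∀ᶠ σ in 𝓝[<] τ, (γ σ).1 = (γ τ).1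
  right : ∀ τ : ℝ, ∃ y, Jumps B (γ τ).2 (γ τ).1 y ∧ ∀ᶠ σ in 𝓝[>] τ, (γ σ).1 = y

/-- `γ` is a cycle of length `L`: a closed trajectory (extended periodically to `ℝ`), where `L` is
the smallest positive number with `γ L = γ 0`. -/
structure IsCycle (B : Set (Sym2 V × AddCircle β)) (γ : ℝ → V × AddCircle β) (L : ℝ) : Prop where
  trajectory : IsTrajectory B γ
  periodic : Function.Periodic γ L
  length : IsLeast {L' : ℝ | 0 < L' ∧ γ L' = γ 0} L

/-- The set of cycles; cycles with the same support are identified, so that a cycle is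
represented by its support. -/
def cycles (B : Set (Sym2 V × AddCircle β)) : Set (Set (V × AddCircle β)) :=
  {c | ∃ γ L, IsCycle B γ L ∧ c = γ '' Set.Icc 0 L}

/-- The length of the cycle with support `c`. -/
def cycleLength (B : Set (Sym2 V × AddCircle β)) (c : Set (V × AddCircle β)) : ℝ :=
  sInf {L | ∃ γ, IsCycle B γ L ∧ c = γ '' Set.Icc 0 L}

/-- The cycle that contains the point `(x, 0)`. -/
def cycleAt (B : Set (Sym2 V × AddCircle β)) (x : V) : Set (V × AddCircle β) :=
  Classical.epsilon fun c => c ∈ cycles B ∧ (x, 0) ∈ c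

/-- The weight `∏_γ 2 cosh (h L(γ))`, the product over all cycles. -/
def cycleWeight (B : Set (Sym2 V × AddCircle β)) (h : ℝ) : ℝ :=
  ∏ᶠ c ∈ cycles B, 2 * Real.cosh (h * cycleLength B c)

/-- `tanh (h L(γ_x))`, where `γ_x` is the cycle that contains `(x, 0)`. -/
def cycleTanh (B : Set (Sym2 V × AddCircle β)) (h : ℝ) (x : V) : ℝ :=
  Real.tanh (h * cycleLength B (cycleAt B x))

open scoped Classical in
/-- `1` if `γ_x = γ_y`, and `tanh (h L(γ_x)) tanh (h L(γ_y))` otherwise. -/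
def pairFactor (B : Set (Sym2 V × AddCircle β)) (h : ℝ) (x y : V) : ℝ :=
  if cycleAt B x = cycleAt B y then 1 else cycleTanh B h x * cycleTanh B h y

end Cycles

section Poisson

variable {V : Type*}

instance edgeMeasurableSpace (G : SimpleGraph V) : MeasurableSpace G.edgeSet := ⊤

/-- Realizations of the Poisson edge process: finite sequences `((e₁, t₁), …, (e_k, t_k))`. -/
abbrev BridgeSeq (G : SimpleGraph V) : Type _ := Σ k : ℕ, (Fin k → G.edgeSet × ℝ)

/-- The possible times `0 < t₁ < ⋯ < t_k < β`. -/
def timeSimplex (k : ℕ) (β : ℝ) : Set (Fin k → ℝ) :=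
  {t | StrictMono t ∧ ∀ i, t i ∈ Set.Ioo 0 β}

/-- The law of `k` bridges: the edges are independent and uniform, the times are uniform in
`0 < t₁ < ⋯ < t_k < β`, and independent of the edges. -/
def bridgeLaw (G : SimpleGraph V) (β : ℝ) (k : ℕ) : Measure (Fin k → G.edgeSet × ℝ) :=
  ((uniformOn (Set.univ : Set (Fin k → G.edgeSet))).prod
    (cond (volume : Measure (Fin k → ℝ)) (timeSimplex k β))).map fun p i => (p.1 i, p.2 i)

/-- The law `ρ` of the Poisson edge process, i.e. of independent unit intensity Poisson processes
on `[0, β]` attached to the edges: the number of bridges is Poisson with mean `β |E|`,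
and given that there are `k` bridges their law is `bridgeLaw G β k`. -/
def poissonEdgeLaw [Fintype V] (G : SimpleGraph V) [DecidableRel G.Adj] (β : ℝ) :
    Measure (BridgeSeq G) :=
  Measure.sum fun k =>
    poissonMeasure (β * G.edgeFinset.card).toNNReal {k} • (bridgeLaw G β k).map (Sigma.mk k)

/-- The bridges of `ω`, as a subset of `E × [0, β]_per`. -/
def bridges {G : SimpleGraph V} (β : ℝ) (ω : BridgeSeq G) : Set (Sym2 V × AddCircle β) :=
  Set.range fun i => ((ω.2 i).1.1, ((ω.2 i).2 : AddCircle β))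

/-- The random cycle measure: the probability measure proportional to
`∏_γ 2 cosh (h L(γ)) dρ`. -/
def cycleMeasure [Fintype V] (G : SimpleGraph V) [DecidableRel G.Adj] (β h : ℝ) :
    Measure (BridgeSeq G) :=
  (∫⁻ ω, ENNReal.ofReal (cycleWeight (bridges β ω) h) ∂poissonEdgeLaw G β)⁻¹ •
    (poissonEdgeLaw G β).withDensity fun ω => ENNReal.ofReal (cycleWeight (bridges β ω) h)

end Poisson

end HeisenbergCycles

end

/-!
The proof reduces both sides to the permutation `π = τ_{e_k} ⋯ τ_{e_1}` of the vertices, where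
`τ_e` is the transposition of the endpoints of the edge `e`.

On the quantum side, `S_x · S_y = T_{xy} / 2 - 1 / 4` (`spinDot_eq`), where `T_{xy}` exchanges two
tensor factors. Hence `-2 β H = β ∑_e T_e - β |E| / 2 + 2 β h ∑_x S_x⁽³⁾`. The magnetic field
commutes with every `T_e`, so that its exponential splits off (`exp_smul_hamiltonian`), and the
exponential series of `β ∑_e T_e` expands a Gibbs trace as `∑_k β ^ k / k! ∑_{e_1, …, e_k}` of the
trace of the observable times `T_{e_1} ⋯ T_{e_k}` times a diagonal operator (`hasSum_gibbsTrace`).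
For an observable that is diagonal in the basis of the spin configurations, this trace is a sum over
the configurations that are invariant under `π` (`invariantSum`). Such configurations choose one
spin per orbit of `π`, and the sum factorizes into hyperbolic functions of `h β |q|`, for the orbits
`q` (`invariantSum_one`, `invariantSum_spinSign`, `invariantSum_spinSign_mul`).

On the probabilistic side, almost every realization has times `0 < t₁ < ⋯ < t_k < β`. The bridges
then generate a flow of permutations: a particle at `x` at time `0` is at `Q τ x` at time `τ`, and
`Q (τ + β) = Q τ * π` (`isFlow_bridges`). Pulling a trajectory back along the flow gives a locally
constant function on the line, so that every trajectory follows the flow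
(`IsFlow.exists_eq_flowPath`). Therefore the cycles correspond to the orbits of `π`, and the cycle
of an orbit `q` has the length `β |q|` (`IsFlow.cycles_eq`, `IsFlow.cycleLength_cycleAt`). All cycle
weights are thus almost everywhere functions of `π`. The expectation of a function of `π` is
`e^{-β |E|} ∑_k β ^ k / k! ∑_{e_1, …, e_k}` (`hasSum_integral_realizationPerm`), which is the
quantum expansion up to the factor `e^{β |E| / 2}` (`gibbsTrace_diagonal`).
-/

noncomputable section

namespace HeisenbergCycles

/-! ### Shifted one-sided neighbourhoods and periods of permutations -/

theorem tendsto_add_nhdsLt (s τ : ℝ) :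
    Tendsto (fun σ => s + σ) (𝓝[<] τ) (𝓝[<] (s + τ)) := by
  refine tendsto_nhdsWithin_iff.2 ⟨?_, ?_⟩
  · exact ((continuous_const.add continuous_id).tendsto τ).mono_left nhdsWithin_le_nhds
  · filter_upwards [self_mem_nhdsWithin] with σ hσ
    exact add_lt_add_right hσ s

theorem tendsto_add_nhdsGt (s τ : ℝ) :
    Tendsto (fun σ => s + σ) (𝓝[>] τ) (𝓝[>] (s + τ)) := by
  refine tendsto_nhdsWithin_iff.2 ⟨?_, ?_⟩
  · exact ((continuous_const.add continuous_id).tendsto τ).mono_left nhdsWithin_le_nhds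
  · filter_upwards [self_mem_nhdsWithin] with σ hσ
    exact add_lt_add_right hσ s

section MinimalPeriod

variable {V : Type*}

theorem pow_minimalPeriod_apply (π : Equiv.Perm V) (w : V) :
    (π ^ (Function.minimalPeriod π w : ℤ)) w = w := by
  rw [zpow_natCast, ← Equiv.Perm.iterate_eq_pow]
  exact Function.iterate_minimalPeriod

theorem minimalPeriod_pos [Finite V] (π : Equiv.Perm V) (w : V) : 0 < Function.minimalPeriod π w :=
  Function.minimalPeriod_pos_of_mem_periodicPts (π.injective.mem_periodicPts w)

theorem minimalPeriod_eq_of_sameCycle {π : Equiv.Perm V} {x y : V} (h : π.SameCycle x y) :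
    Function.minimalPeriod π x = Function.minimalPeriod π y := by
  obtain ⟨n, rfl⟩ := h
  refine Nat.dvd_antisymm ?_ ?_ <;> rw [← Function.isPeriodicPt_iff_minimalPeriod_dvd]
  · have h := pow_minimalPeriod_apply π ((π ^ n) x)
    rw [← Equiv.Perm.mul_apply, ← zpow_add, add_comm, zpow_add, Equiv.Perm.mul_apply] at h
    have := (π ^ n).injective h
    rwa [zpow_natCast, ← Equiv.Perm.iterate_eq_pow] at this
  · have h : (π ^ (Function.minimalPeriod π x : ℤ)) ((π ^ n) x) = (π ^ n) x := by
      rw [← Equiv.Perm.mul_apply, ← zpow_add, add_comm, zpow_add, Equiv.Perm.mul_apply,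
        pow_minimalPeriod_apply]
    rwa [zpow_natCast, ← Equiv.Perm.iterate_eq_pow] at h

end MinimalPeriod

/-! ### Trajectories and cycles in terms of a flow of permutations -/

section Flow

variable {V : Type*} {β : ℝ}

/-- The flow of a bridge configuration `B`: the particle that starts at the vertex `x` at time `0`
is at the vertex `Q τ x` at time `τ`, and `π` is the permutation of `V` that is produced by one
turn around the time circle. -/
structure IsFlow (B : Set (Sym2 V × AddCircle β)) (Q : ℝ → Equiv.Perm V) (π : Equiv.Perm V) :
    Prop where
  zero : Q 0 = 1
  add_period : ∀ τ, Q (τ + β) = Q τ * π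
  left : ∀ τ, ∀ᶠ σ in 𝓝[<] τ, Q σ = Q τ
  right : ∀ τ : ℝ, ∃ J : Equiv.Perm V, (∀ x y, Jumps B (τ : AddCircle β) x y ↔ y = J x) ∧
    ∀ᶠ σ in 𝓝[>] τ, Q σ = J * Q τ

/-- The trajectory that is at the vertex `Q s w` at time `s`, when the parameter is `0`. -/
def flowPath (β : ℝ) (Q : ℝ → Equiv.Perm V) (s : ℝ) (w : V) (τ : ℝ) : V × AddCircle β :=
  (Q (s + τ) w, ((s + τ : ℝ) : AddCircle β))

/-- The support of the trajectory through `(w, 0)`. -/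
def flowSupport (β : ℝ) (Q : ℝ → Equiv.Perm V) (w : V) : Set (V × AddCircle β) :=
  Set.range fun s : ℝ => (Q s w, (s : AddCircle β))

namespace IsFlow

variable {B : Set (Sym2 V × AddCircle β)} {Q : ℝ → Equiv.Perm V} {π : Equiv.Perm V}

theorem apply_add_zsmul (hQ : IsFlow B Q π) (τ : ℝ) (n : ℤ) : Q (τ + n • β) = Q τ * π ^ n := by
  induction n with
  | zero => simp
  | succ n ih =>
    rw [add_zsmul, one_zsmul, ← add_assoc, hQ.add_period, ih, mul_assoc, zpow_add_one]
  | pred n ih =>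
    have := hQ.add_period (τ + (-(n : ℤ) - 1) • β)
    rw [add_assoc, ← add_one_zsmul, sub_add_cancel, ih] at this
    rw [zpow_sub_one, ← mul_assoc, this, mul_inv_cancel_right]

theorem apply_zsmul (hQ : IsFlow B Q π) (n : ℤ) : Q (n • β) = π ^ n := by
  have := hQ.apply_add_zsmul 0 n
  rwa [zero_add, hQ.zero, one_mul] at this

theorem isTrajectory_flowPath (hQ : IsFlow B Q π) (s : ℝ) (w : V) :
    IsTrajectory B (flowPath β Q s w) where
  time τ := by simp [flowPath]
  left τ := by
    filter_upwards [(tendsto_add_nhdsLt s τ).eventually (hQ.left (s + τ))] with σ hσ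
    simp [flowPath, hσ]
  right τ := by
    obtain ⟨J, hJ, hr⟩ := hQ.right (s + τ)
    refine ⟨J (Q (s + τ) w), (hJ _ _).2 rfl, ?_⟩
    filter_upwards [(tendsto_add_nhdsGt s τ).eventually hr] with σ hσ
    simp [flowPath, hσ]

/-- Every trajectory follows the flow: pulling its position back along the flow gives a locally
constant, hence constant, function. -/
theorem exists_eq_flowPath (hQ : IsFlow B Q π) {γ : ℝ → V × AddCircle β}
    (hγ : IsTrajectory B γ) : ∃ s w, γ = flowPath β Q s w := by
  obtain ⟨s, hs⟩ := QuotientAddGroup.mk_surjective (γ 0).2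
  have htime : ∀ τ, (γ τ).2 = ((s + τ : ℝ) : AddCircle β) := fun τ => by
    rw [hγ.time, ← hs]; rfl
  let u : ℝ → V := fun τ => (Q (s + τ)).symm (γ τ).1
  have hu : IsLocallyConstant u := by
    rw [IsLocallyConstant.iff_eventually_eq]
    intro τ
    have hl : ∀ᶠ σ in 𝓝[<] τ, u σ = u τ := by
      filter_upwards [(tendsto_add_nhdsLt s τ).eventually (hQ.left (s + τ)), hγ.left τ] with σ h1 h2
      simp only [u, h1, h2]
    have hr : ∀ᶠ σ in 𝓝[>] τ, u σ = u τ := by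
      obtain ⟨J, hJ, hr⟩ := hQ.right (s + τ)
      obtain ⟨y, hy, hγr⟩ := hγ.right τ
      rw [htime, hJ] at hy
      filter_upwards [(tendsto_add_nhdsGt s τ).eventually hr, hγr] with σ h1 h2
      simp only [u, h1, h2, hy]
      rw [Equiv.symm_apply_eq, Equiv.Perm.mul_apply, Equiv.apply_symm_apply]
    rw [← pure_sup_nhdsNE, ← nhdsLT_sup_nhdsGT]
    simp [eventually_sup, hl, hr]
  refine ⟨s, u 0, funext fun τ => Prod.ext ?_ (htime τ)⟩
  simp only [flowPath]
  rw [hu.apply_eq_of_preconnectedSpace 0 τ, Equiv.apply_symm_apply]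

theorem flowPath_eq_flowPath_zero_iff (hQ : IsFlow B Q π) (s : ℝ) (w : V) (L : ℝ) :
    flowPath β Q s w L = flowPath β Q s w 0 ↔ ∃ n : ℤ, L = n • β ∧ (π ^ n) w = w := by
  simp only [flowPath, Prod.mk.injEq, add_zero]
  rw [and_comm, AddCircle.coe_add, add_eq_left, AddCircle.coe_eq_zero_iff]
  constructor
  · rintro ⟨⟨n, rfl⟩, h⟩
    refine ⟨n, rfl, ?_⟩
    rw [hQ.apply_add_zsmul, Equiv.Perm.mul_apply] at h
    exact (Q s).injective h
  · rintro ⟨n, rfl, h⟩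
    refine ⟨⟨n, rfl⟩, ?_⟩
    rw [hQ.apply_add_zsmul, Equiv.Perm.mul_apply, h]

theorem periodic_flowPath (hQ : IsFlow B Q π) (s : ℝ) {w : V} {n : ℤ} (h : (π ^ n) w = w) :
    Function.Periodic (flowPath β Q s w) (n • β) := by
  intro τ
  simp only [flowPath, ← add_assoc, hQ.apply_add_zsmul, Equiv.Perm.mul_apply, h, AddCircle.coe_add]
  simp [AddCircle.coe_period]

theorem mem_flowSupport_iff (hQ : IsFlow B Q π) (x w : V) :
    (x, 0) ∈ flowSupport β Q w ↔ π.SameCycle w x := by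
  simp only [flowSupport, Set.mem_range, Prod.mk.injEq]
  constructor
  · rintro ⟨s, hx, hs⟩
    obtain ⟨n, rfl⟩ := (AddCircle.coe_eq_zero_iff β).1 hs
    exact ⟨n, by rw [← hx, hQ.apply_zsmul]⟩
  · rintro ⟨n, hn⟩
    exact ⟨n • β, by rw [hQ.apply_zsmul, hn], (AddCircle.coe_eq_zero_iff β).2 ⟨n, rfl⟩⟩

theorem flowSupport_eq_iff (hQ : IsFlow B Q π) (x w : V) :
    flowSupport β Q x = flowSupport β Q w ↔ π.SameCycle x w := by
  constructor
  · intro h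
    rw [← hQ.mem_flowSupport_iff, h, hQ.mem_flowSupport_iff]
  · rintro ⟨n, rfl⟩
    ext c
    constructor
    · rintro ⟨s, rfl⟩
      refine ⟨s + (-n) • β, ?_⟩
      simp only [hQ.apply_add_zsmul, Equiv.Perm.mul_apply, AddCircle.coe_add]
      simp [AddCircle.coe_period]
    · rintro ⟨s, rfl⟩
      refine ⟨s + n • β, ?_⟩
      simp only [hQ.apply_add_zsmul, Equiv.Perm.mul_apply, AddCircle.coe_add]
      simp [AddCircle.coe_period]

variable [Finite V]

/-- The trajectories close up for the first time after `β` times the length of the orbit of `π`. -/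
theorem isCycle_flowPath_iff (hβ : 0 < β) (hQ : IsFlow B Q π) (s : ℝ) (w : V) (L : ℝ) :
    IsCycle B (flowPath β Q s w) L ↔ L = β * Function.minimalPeriod π w := by
  have hleast : IsLeast {L' : ℝ | 0 < L' ∧ flowPath β Q s w L' = flowPath β Q s w 0}
      (β * Function.minimalPeriod π w) := by
    constructor
    · refine ⟨mul_pos hβ (Nat.cast_pos.2 (minimalPeriod_pos π w)), ?_⟩
      rw [hQ.flowPath_eq_flowPath_zero_iff]
      exact ⟨Function.minimalPeriod π w, by simp [mul_comm], pow_minimalPeriod_apply π w⟩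
    · rintro L' ⟨hpos, h⟩
      obtain ⟨n, rfl, hn⟩ := (hQ.flowPath_eq_flowPath_zero_iff s w L').1 h
      have hn0 : 0 < n := by
        rw [zsmul_eq_mul] at hpos
        exact_mod_cast (pos_iff_pos_of_mul_pos hpos).2 hβ
      lift n to ℕ using hn0.le
      rw [zpow_natCast, ← Equiv.Perm.iterate_eq_pow] at hn
      have := Function.IsPeriodicPt.minimalPeriod_le (by exact_mod_cast hn0) hn
      rw [zsmul_eq_mul, mul_comm, Int.cast_natCast]
      exact mul_le_mul_of_nonneg_right (by exact_mod_cast this) hβ.le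
  constructor
  · intro h
    exact h.length.unique hleast
  · rintro rfl
    refine ⟨hQ.isTrajectory_flowPath s w, ?_, hleast⟩
    have := hQ.periodic_flowPath s (pow_minimalPeriod_apply π w)
    rwa [zsmul_eq_mul, Int.cast_natCast, mul_comm] at this

theorem image_flowPath (hβ : 0 < β) (hQ : IsFlow B Q π) (s : ℝ) (w : V) :
    flowPath β Q s w '' Set.Icc 0 (β * Function.minimalPeriod π w) = flowSupport β Q w := by
  have hp := ((hQ.isCycle_flowPath_iff hβ s w _).2 rfl).periodic
  have hpos : 0 < β * Function.minimalPeriod π w :=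
    mul_pos hβ (Nat.cast_pos.2 (minimalPeriod_pos π w))
  have := hp.image_Icc hpos 0
  rw [zero_add] at this
  rw [this]
  ext c
  constructor
  · rintro ⟨τ, rfl⟩
    exact ⟨s + τ, rfl⟩
  · rintro ⟨τ, rfl⟩
    exact ⟨τ - s, by simp [flowPath]⟩

theorem cycles_eq (hβ : 0 < β) (hQ : IsFlow B Q π) :
    cycles B = Set.range (flowSupport β Q) := by
  ext c
  constructor
  · rintro ⟨γ, L, hγ, rfl⟩
    obtain ⟨s, w, rfl⟩ := hQ.exists_eq_flowPath hγ.trajectory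
    rw [(hQ.isCycle_flowPath_iff hβ s w L).1 hγ, hQ.image_flowPath hβ]
    exact ⟨w, rfl⟩
  · rintro ⟨w, rfl⟩
    exact ⟨flowPath β Q 0 w, _, (hQ.isCycle_flowPath_iff hβ 0 w _).2 rfl,
      (hQ.image_flowPath hβ 0 w).symm⟩

theorem cycleAt_eq (hβ : 0 < β) (hQ : IsFlow B Q π) (x : V) :
    cycleAt B x = flowSupport β Q x := by
  have hex : ∃ c, c ∈ cycles B ∧ (x, 0) ∈ c :=
    ⟨flowSupport β Q x, by rw [hQ.cycles_eq hβ]; exact ⟨x, rfl⟩,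
      (hQ.mem_flowSupport_iff x x).2 (Equiv.Perm.SameCycle.refl π x)⟩
  have h : cycleAt B x ∈ cycles B ∧ (x, 0) ∈ cycleAt B x := Classical.epsilon_spec hex
  rw [hQ.cycles_eq hβ] at h
  obtain ⟨⟨w, hw⟩, hx⟩ := h
  rw [← hw] at hx ⊢
  exact (hQ.flowSupport_eq_iff w x).2 ((hQ.mem_flowSupport_iff x w).1 hx)

theorem cycleAt_eq_cycleAt_iff (hβ : 0 < β) (hQ : IsFlow B Q π) (x y : V) :
    cycleAt B x = cycleAt B y ↔ π.SameCycle x y := by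
  rw [hQ.cycleAt_eq hβ, hQ.cycleAt_eq hβ, hQ.flowSupport_eq_iff]

theorem cycleLength_flowSupport (hβ : 0 < β) (hQ : IsFlow B Q π) (x : V) :
    cycleLength B (flowSupport β Q x) = β * Function.minimalPeriod π x := by
  have : {L | ∃ γ, IsCycle B γ L ∧ flowSupport β Q x = γ '' Set.Icc 0 L} =
      {β * (Function.minimalPeriod π x : ℝ)} := by
    ext L
    constructor
    · rintro ⟨γ, hγ, hx⟩
      obtain ⟨s, w, rfl⟩ := hQ.exists_eq_flowPath hγ.trajectory
      have hL := (hQ.isCycle_flowPath_iff hβ s w L).1 hγ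
      rw [hL, hQ.image_flowPath hβ, hQ.flowSupport_eq_iff] at hx
      rw [Set.mem_singleton_iff, hL, minimalPeriod_eq_of_sameCycle hx]
    · rintro rfl
      exact ⟨flowPath β Q 0 x, (hQ.isCycle_flowPath_iff hβ 0 x _).2 rfl,
        (hQ.image_flowPath hβ 0 x).symm⟩
  rw [cycleLength, this, csInf_singleton]

end IsFlow

end Flow

/-! ### The flow of a finite sequence of bridges -/

/-- The product `a_{k-1} ⋯ a₁ a₀`, with later factors on the left. -/
def orderedProd {M : Type*} [Monoid M] : (k : ℕ) → (Fin k → M) → M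
  | 0, _ => 1
  | k + 1, a => a (Fin.last k) * orderedProd k fun i => a i.castSucc

theorem orderedProd_eq_one {M : Type*} [Monoid M] {k : ℕ} {a : Fin k → M} (h : ∀ i, a i = 1) :
    orderedProd k a = 1 := by
  induction k with
  | zero => rfl
  | succ k ih => rw [orderedProd, h, ih fun i => h _, mul_one]

theorem orderedProd_eq_single {M : Type*} [Monoid M] {k : ℕ} {a : Fin k → M} (j : Fin k)
    (h : ∀ i, i ≠ j → a i = 1) : orderedProd k a = a j := by
  induction k with
  | zero => exact j.elim0
  | succ k ih =>
    rw [orderedProd]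
    cases j using Fin.lastCases with
    | last => rw [orderedProd_eq_one fun i => h _ i.castSucc_ne_last, mul_one]
    | cast j =>
      rw [h _ j.castSucc_ne_last.symm, one_mul, ih j]
      exact fun i hi => h _ fun hc => hi (Fin.castSucc_injective _ hc)

section StepProd

variable {M : Type*} [Monoid M] {k : ℕ}

/-- The ordered product of those `a i` that have occurred strictly before the time `r`. -/
def stepProd (a : Fin k → M) (t : Fin k → ℝ) (r : ℝ) : M :=
  orderedProd k fun i => if t i < r then a i else 1

/-- The ordered product of those `a i` that occur at the time `r`. -/
def jumpProd (a : Fin k → M) (t : Fin k → ℝ) (r : ℝ) : M :=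
  orderedProd k fun i => if t i = r then a i else 1

theorem eventually_stepProd_nhdsLT (a : Fin k → M) (t : Fin k → ℝ) (r : ℝ) :
    ∀ᶠ s in 𝓝[<] r, stepProd a t s = stepProd a t r := by
  have : ∀ᶠ s in 𝓝[<] r, ∀ i, t i < s ↔ t i < r := by
    refine eventually_all.2 fun i => ?_
    by_cases hi : t i < r
    · filter_upwards [Ioo_mem_nhdsLT hi] with s hs
      simp [hs.1, hi]
    · filter_upwards [self_mem_nhdsWithin] with s hs
      simp only [hi, iff_false, not_lt]
      exact (le_of_lt hs).trans (not_lt.1 hi)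
  filter_upwards [this] with s hs
  simp [stepProd, hs]

/-- Since the factors with later times stand on the left, a factor that is switched on at the time
`r` appears on the left of the product: all factors further to the left are still trivial. -/
theorem eventually_stepProd_nhdsGT (a : Fin k → M) {t : Fin k → ℝ} (ht : StrictMono t) (r : ℝ) :
    ∀ᶠ s in 𝓝[>] r, stepProd a t s = jumpProd a t r * stepProd a t r := by
  induction k with
  | zero => simp [stepProd, jumpProd, orderedProd]
  | succ k ih =>
    have hlast : ∀ᶠ s in 𝓝[>] r, t (Fin.last k) < s ↔ t (Fin.last k) ≤ r := by
      by_cases hi : t (Fin.last k) ≤ r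
      · filter_upwards [self_mem_nhdsWithin] with s hs
        simp only [hi, iff_true]
        exact hi.trans_lt hs
      · filter_upwards [Ioo_mem_nhdsGT (not_le.1 hi)] with s hs
        simp [hs.2.le, hi]
    filter_upwards [hlast, ih (fun i => a i.castSucc) (ht.comp (Fin.strictMono_castSucc))]
      with s h1 h2
    simp only [stepProd, jumpProd, orderedProd, h1] at h2 ⊢
    simp only [Function.comp] at h2
    rw [h2]
    rcases lt_trichotomy (t (Fin.last k)) r with h | h | h
    · rw [orderedProd_eq_one (a := fun i : Fin k => if t i.castSucc = r then a i.castSucc else 1)]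
      · simp [h, h.le, h.ne]
      · intro i
        rw [if_neg]
        exact ((ht (Fin.castSucc_lt_last i)).trans h).ne
    · simp [h, mul_assoc]
    · simp [h.not_ge, h.not_gt, h.ne']

theorem stepProd_of_forall_lt (a : Fin k → M) {t : Fin k → ℝ} {r : ℝ} (h : ∀ i, t i < r) :
    stepProd a t r = orderedProd k a := by
  simp [stepProd, h]

theorem stepProd_of_forall_le (a : Fin k → M) {t : Fin k → ℝ} {r : ℝ} (h : ∀ i, r ≤ t i) :
    stepProd a t r = 1 :=
  orderedProd_eq_one fun i => if_neg (h i).not_gt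

end StepProd

section PeriodicFlow

variable {V : Type*} {β : ℝ} {k : ℕ}

/-- The flow of the permutations `a i` that act at the times `t i ∈ (0, β)` and, periodically, at
the translates of these times by the multiples of `β`. -/
def periodicFlow (β : ℝ) (a : Fin k → Equiv.Perm V) (t : Fin k → ℝ) (τ : ℝ) : Equiv.Perm V :=
  stepProd a t (τ - ⌊τ / β⌋ * β) * orderedProd k a ^ ⌊τ / β⌋

/-- The formula that defines `periodicFlow` on `[nβ, (n + 1)β)` holds at the right end point too,
because no time `t i` is `0` or `β`. -/
theorem periodicFlow_eq (hβ : 0 < β) (a : Fin k → Equiv.Perm V) {t : Fin k → ℝ}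
    (ht : ∀ i, t i ∈ Set.Ioo 0 β) {τ : ℝ} {n : ℤ} (hτ : τ - n * β ∈ Set.Icc 0 β) :
    periodicFlow β a t τ = stepProd a t (τ - n * β) * orderedProd k a ^ n := by
  rcases hτ.2.eq_or_lt with h | h
  · have hfl : ⌊τ / β⌋ = n + 1 := by
      have : τ / β = ((n + 1 : ℤ) : ℝ) := by
        rw [div_eq_iff hβ.ne']; push_cast; linarith
      rw [this, Int.floor_intCast]
    have h0 : τ - (n + 1 : ℤ) * β = 0 := by push_cast; linarith
    rw [periodicFlow, hfl, h0, h, stepProd_of_forall_le a fun i => (ht i).1.le,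
      stepProd_of_forall_lt a fun i => (ht i).2, one_mul, add_comm, zpow_add, zpow_one]
  · have hfl : ⌊τ / β⌋ = n := by
      rw [Int.floor_eq_iff, le_div_iff₀ hβ, div_lt_iff₀ hβ]
      constructor <;> linarith [hτ.1]
    rw [periodicFlow, hfl]

theorem periodicFlow_isFlow (hβ : 0 < β) (a : Fin k → Equiv.Perm V) {t : Fin k → ℝ}
    (ht : StrictMono t) (ht' : ∀ i, t i ∈ Set.Ioo 0 β) {B : Set (Sym2 V × AddCircle β)}
    (hB : ∀ r ∈ Set.Ico 0 β, ∀ x y, Jumps B (r : AddCircle β) x y ↔ y = jumpProd a t r x) :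
    IsFlow B (periodicFlow β a t) (orderedProd k a) where
  zero := by
    rw [periodicFlow_eq hβ a ht' (n := 0) (by simp [hβ.le])]
    simp [stepProd_of_forall_le a fun i => (ht' i).1.le]
  add_period τ := by
    have : (τ + β) / β = τ / β + 1 := by rw [add_div, div_self hβ.ne']
    have h2 : τ + β - ((⌊τ / β⌋ : ℝ) + 1) * β = τ - ⌊τ / β⌋ * β := by ring
    rw [periodicFlow, periodicFlow, this, Int.floor_add_one]
    push_cast
    rw [h2, zpow_add_one, mul_assoc]
  left τ := by
    obtain ⟨n, ⟨hn1, hn2⟩, -⟩ := existsUnique_sub_zsmul_mem_Ioc hβ τ 0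
    rw [zsmul_eq_mul] at hn1 hn2
    rw [zero_add] at hn2
    have h := tendsto_add_nhdsLt (-(n * β)) τ
    filter_upwards [h.eventually (eventually_stepProd_nhdsLT a t (-(n * β) + τ)),
      Ioo_mem_nhdsLT (show n * β < τ by linarith)] with σ h1 h2
    rw [neg_add_eq_sub, neg_add_eq_sub] at h1
    rw [periodicFlow_eq hβ a ht' (n := n) ⟨by linarith [h2.1], by linarith [h2.2]⟩,
      periodicFlow_eq hβ a ht' (n := n) ⟨hn1.le, hn2⟩, h1]
  right τ := by
    obtain ⟨n, ⟨hn1, hn2⟩, -⟩ := existsUnique_sub_zsmul_mem_Ico hβ τ 0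
    rw [zsmul_eq_mul] at hn1 hn2
    rw [zero_add] at hn2
    have hcoe : (τ : AddCircle β) = ((τ - n * β : ℝ) : AddCircle β) := by
      rw [AddCircle.coe_sub, (AddCircle.coe_eq_zero_iff β).2 ⟨n, zsmul_eq_mul _ _⟩, sub_zero]
    refine ⟨jumpProd a t (τ - n * β), fun x y => ?_, ?_⟩
    · rw [hcoe]
      exact hB _ ⟨hn1, hn2⟩ x y
    have h := tendsto_add_nhdsGt (-(n * β)) τ
    filter_upwards [h.eventually (eventually_stepProd_nhdsGT a ht (-(n * β) + τ)),
      Ioo_mem_nhdsGT (show τ < β + n * β by linarith)] with σ h1 h2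
    rw [neg_add_eq_sub, neg_add_eq_sub] at h1
    rw [periodicFlow_eq hβ a ht' (n := n) ⟨by linarith [h2.1], by linarith [h2.2]⟩,
      periodicFlow_eq hβ a ht' (n := n) ⟨hn1, hn2.le⟩, h1, mul_assoc]

end PeriodicFlow

section Bridges

variable {V : Type*} [DecidableEq V]

/-- The transposition of the two endpoints of an edge. -/
def edgeSwap (e : Sym2 V) : Equiv.Perm V := Sym2.lift ⟨Equiv.swap, Equiv.swap_comm⟩ e

/-- The permutation of `V` that is produced by crossing the edges `e₁, …, e_k` in this order. -/
def bridgePerm {G : SimpleGraph V} {k : ℕ} (e : Fin k → G.edgeSet) : Equiv.Perm V :=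
  orderedProd k fun i => edgeSwap (e i).1

/-- The jump rule at a bridge on `e` is the action of the transposition `edgeSwap e`. -/
theorem edgeSwap_jump_iff {e : Sym2 V} (he : ¬ e.IsDiag) (x y : V) :
    (s(x, y) = e ∨ (y = x ∧ x ∉ e)) ↔ y = edgeSwap e x := by
  induction e using Sym2.ind with
  | _ a b =>
    have hab : a ≠ b := by simpa using he
    simp only [edgeSwap, Sym2.lift_mk, Sym2.eq_iff, Sym2.mem_iff]
    by_cases hxa : x = a
    · subst hxa
      rw [Equiv.swap_apply_left]
      simp [hab]
    · by_cases hxb : x = b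
      · subst hxb
        rw [Equiv.swap_apply_right]
        simp [hxa]
      · rw [Equiv.swap_apply_of_ne_of_ne hxa hxb]
        simp [hxa, hxb]

theorem jumps_bridges_iff {G : SimpleGraph V} {β : ℝ} (hβ : 0 < β) (ω : BridgeSeq G)
    (ht : (fun i => (ω.2 i).2) ∈ timeSimplex ω.1 β) {r : ℝ} (hr : r ∈ Set.Ico 0 β) (x y : V) :
    Jumps (bridges β ω) (r : AddCircle β) x y ↔
      y = jumpProd (fun i => edgeSwap (ω.2 i).1.1) (fun i => (ω.2 i).2) r x := by
  have : Fact (0 < β) := ⟨hβ⟩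
  have hmem : ∀ e : Sym2 V, (e, (r : AddCircle β)) ∈ bridges β ω ↔
      ∃ i, (ω.2 i).1.1 = e ∧ (ω.2 i).2 = r := by
    intro e
    simp only [bridges, Set.mem_range, Prod.mk.injEq]
    refine exists_congr fun i => and_congr_right fun _ => ?_
    exact AddCircle.coe_eq_coe_iff_of_mem_Ico (a := 0)
      ⟨(ht.2 i).1.le, by simpa using (ht.2 i).2⟩ (by simpa using hr)
  simp only [Jumps, hmem]
  by_cases h : ∃ j, (ω.2 j).2 = r
  · obtain ⟨j, hj⟩ := h
    have huniq : ∀ i, (ω.2 i).2 = r ↔ i = j := fun i =>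
      ⟨fun hi => ht.1.injective (hi.trans hj.symm), fun hi => hi ▸ hj⟩
    rw [jumpProd, orderedProd_eq_single j fun i hi => if_neg (mt (huniq i).1 hi), if_pos hj,
      ← edgeSwap_jump_iff (G.not_isDiag_of_mem_edgeSet (ω.2 j).1.2)]
    simp only [huniq, exists_eq_right]
    refine or_congr eq_comm (and_congr_right fun _ => ?_)
    constructor
    · exact fun hx hxe => hx _ hxe rfl
    · rintro hx e hxe rfl
      exact hx hxe
  · push Not at h
    rw [jumpProd, orderedProd_eq_one fun i => if_neg (h i)]
    simp [h]

/-- If the times of the bridges are increasing, the permutation that is produced by one turn around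
the time circle depends only on the sequence of the edges. -/
theorem isFlow_bridges {G : SimpleGraph V} {β : ℝ} (hβ : 0 < β) (ω : BridgeSeq G)
    (ht : (fun i => (ω.2 i).2) ∈ timeSimplex ω.1 β) :
    IsFlow (bridges β ω)
      (periodicFlow β (fun i => edgeSwap (ω.2 i).1.1) fun i => (ω.2 i).2)
      (bridgePerm fun i => (ω.2 i).1) :=
  periodicFlow_isFlow hβ _ ht.1 ht.2 fun _ hr => jumps_bridges_iff hβ ω ht hr

end Bridges

/-! ### Sums over the spin configurations that are invariant under a permutation -/

section Orbits

variable {V : Type*}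

/-- The orbits of the permutation `π`. -/
def PermOrbit (π : Equiv.Perm V) : Type _ := Quotient (Equiv.Perm.SameCycle.setoid π)

/-- The orbit of `x`. -/
def orbitMk (π : Equiv.Perm V) (x : V) : PermOrbit π := Quotient.mk _ x

theorem orbitMk_surjective (π : Equiv.Perm V) : Function.Surjective (orbitMk π) :=
  Quotient.mk_surjective

theorem orbitMk_eq_iff {π : Equiv.Perm V} {x y : V} :
    orbitMk π x = orbitMk π y ↔ π.SameCycle x y := Quotient.eq

/-- The functions that are invariant under `π` are the functions of the orbit. -/
theorem comp_perm_eq_iff {α : Type*} (π : Equiv.Perm V) (s : V → α) :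
    s ∘ π = s ↔ ∃ u : PermOrbit π → α, u ∘ orbitMk π = s := by
  constructor
  · intro h
    have hz : ∀ (n : ℤ) x, s ((π ^ n) x) = s x := by
      intro n
      induction n with
      | zero => simp
      | succ n ih =>
        intro x
        rw [zpow_add_one, Equiv.Perm.mul_apply, ih]
        exact congrFun h x
      | pred n ih =>
        intro x
        rw [zpow_sub_one, Equiv.Perm.mul_apply, ih, ← congrFun h (π⁻¹ x)]
        simp
    refine ⟨Quotient.lift s ?_, rfl⟩
    rintro x y ⟨n, rfl⟩
    exact (hz n x).symm
  · rintro ⟨u, rfl⟩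
    funext x
    exact congrArg u (orbitMk_eq_iff.2 (Equiv.Perm.sameCycle_apply_left.2
      (Equiv.Perm.SameCycle.refl π x)))

variable [Fintype V]

instance (π : Equiv.Perm V) : Finite (PermOrbit π) :=
  inferInstanceAs (Finite (Quotient (Equiv.Perm.SameCycle.setoid π)))

instance (π : Equiv.Perm V) : Fintype (PermOrbit π) := Fintype.ofFinite _

instance (π : Equiv.Perm V) : DecidableEq (PermOrbit π) := Classical.decEq _

/-- The number of elements of an orbit. -/
def orbitSize {π : Equiv.Perm V} (q : PermOrbit π) : ℕ :=
  (Finset.univ.filter fun x => orbitMk π x = q).card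

theorem orbitSize_orbitMk (π : Equiv.Perm V) (x : V) :
    orbitSize (orbitMk π x) = Function.minimalPeriod π x := by
  classical
  have h := MulAction.minimalPeriod_eq_card π x
  change Function.minimalPeriod π x = _ at h
  rw [h, orbitSize, ← Set.toFinset_card]
  congr 1
  ext y
  simp only [Finset.mem_filter, Finset.mem_univ, true_and, Set.mem_toFinset]
  rw [orbitMk_eq_iff, Equiv.Perm.sameCycle_comm]
  constructor
  · rintro ⟨n, rfl⟩
    exact ⟨⟨π ^ n, n, rfl⟩, rfl⟩
  · rintro ⟨⟨_, n, rfl⟩, rfl⟩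
    exact ⟨n, rfl⟩

/-- The eigenvalue `±1` of `2 S⁽³⁾`. -/
def spinSign : Fin 2 → ℝ := ![1, -1]

theorem spinSign_mul_self (a : Fin 2) : spinSign a * spinSign a = 1 := by
  fin_cases a <;> simp [spinSign]

theorem sum_prod_orbit {π : Equiv.Perm V} (f : PermOrbit π → Fin 2 → ℝ) :
    ∑ u : PermOrbit π → Fin 2, ∏ q, f q (u q) = ∏ q, (f q 0 + f q 1) := by
  simp_rw [← Fin.sum_univ_two]
  rw [Finset.prod_univ_sum, Fintype.piFinset_univ]

/-- The product of `2 cosh (c |q|)` over the orbits `q` of `π`. -/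
def orbitWeight (π : Equiv.Perm V) (c : ℝ) : ℝ :=
  ∏ q : PermOrbit π, 2 * Real.cosh (c * orbitSize q)

/-- `tanh (c |q|)` for the orbit `q` of `x`. -/
def orbitTanh (π : Equiv.Perm V) (c : ℝ) (x : V) : ℝ := Real.tanh (c * orbitSize (orbitMk π x))

theorem orbitWeight_pos (π : Equiv.Perm V) (c : ℝ) : 0 < orbitWeight π c :=
  Finset.prod_pos fun _ _ => mul_pos two_pos (Real.cosh_pos _)

variable [DecidableEq V]

/-- The sum of `a s * exp (c ∑ₓ ±1)` over the configurations `s` that are invariant under `π`. -/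
def invariantSum (π : Equiv.Perm V) (c : ℝ) (a : (V → Fin 2) → ℝ) : ℝ :=
  ∑ s : V → Fin 2, if s ∘ π = s then a s * Real.exp (c * ∑ x, spinSign (s x)) else 0

theorem invariantSum_const_mul (π : Equiv.Perm V) (c r : ℝ) (a : (V → Fin 2) → ℝ) :
    invariantSum π c (fun s => r * a s) = r * invariantSum π c a := by
  simp only [invariantSum, Finset.mul_sum, mul_ite, mul_zero, mul_assoc]

/-- An invariant configuration is a choice of one spin for each orbit. -/
theorem invariantSum_eq (π : Equiv.Perm V) (c : ℝ) (a : (V → Fin 2) → ℝ) :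
    invariantSum π c a = ∑ u : PermOrbit π → Fin 2,
      a (u ∘ orbitMk π) * ∏ q, Real.exp (c * orbitSize q * spinSign (u q)) := by
  have hinj : Function.Injective fun (u : PermOrbit π → Fin 2) => u ∘ orbitMk π :=
    (orbitMk_surjective π).injective_comp_right
  rw [invariantSum, ← Finset.sum_filter]
  have : (Finset.univ.filter fun s : V → Fin 2 => s ∘ π = s) =
      Finset.univ.image fun (u : PermOrbit π → Fin 2) => u ∘ orbitMk π := by
    ext s
    simp [comp_perm_eq_iff]
  rw [this, Finset.sum_image hinj.injOn]
  refine Finset.sum_congr rfl fun u _ => ?_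
  rw [← Real.exp_sum, ← Finset.sum_fiberwise _ (orbitMk π), Finset.mul_sum]
  congr 2
  refine Finset.sum_congr rfl fun q _ => ?_
  rw [Finset.sum_congr rfl (g := fun _ => spinSign (u q))]
  · rw [Finset.sum_const, nsmul_eq_mul, mul_assoc]
    rfl
  · intro x hx
    rw [Function.comp, (Finset.mem_filter.1 hx).2]

theorem exp_add_exp_spinSign (c : ℝ) :
    Real.exp (c * spinSign 0) + Real.exp (c * spinSign 1) = 2 * Real.cosh c := by
  simp [spinSign, Real.cosh_eq]; ring

theorem exp_sub_exp_spinSign (c : ℝ) :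
    spinSign 0 * Real.exp (c * spinSign 0) + spinSign 1 * Real.exp (c * spinSign 1) =
      Real.tanh c * (2 * Real.cosh c) := by
  rw [Real.tanh_eq_sinh_div_cosh, mul_left_comm, div_mul_cancel₀ _ (Real.cosh_pos c).ne']
  simp [spinSign, Real.sinh_eq]; ring

theorem invariantSum_one (π : Equiv.Perm V) (c : ℝ) :
    invariantSum π c (fun _ => 1) = orbitWeight π c := by
  simp only [invariantSum_eq, one_mul]
  rw [sum_prod_orbit fun q a => Real.exp (c * orbitSize q * spinSign a)]
  simp only [exp_add_exp_spinSign, orbitWeight]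

theorem invariantSum_spinSign (π : Equiv.Perm V) (c : ℝ) (x : V) :
    invariantSum π c (fun s => spinSign (s x)) = orbitTanh π c x * orbitWeight π c := by
  rw [invariantSum_eq]
  have h : ∀ u : PermOrbit π → Fin 2,
      spinSign ((u ∘ orbitMk π) x) * ∏ q, Real.exp (c * orbitSize q * spinSign (u q)) =
      ∏ q, (if q = orbitMk π x then spinSign (u q) else 1) *
        Real.exp (c * orbitSize q * spinSign (u q)) := by
    intro u
    rw [Finset.prod_mul_distrib, Finset.prod_ite_eq' Finset.univ]
    simp
  simp_rw [h]
  rw [sum_prod_orbit fun q a => (if q = orbitMk π x then spinSign a else 1) *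
    Real.exp (c * orbitSize q * spinSign a)]
  have h2 : ∀ q : PermOrbit π,
      (if q = orbitMk π x then spinSign 0 else 1) * Real.exp (c * orbitSize q * spinSign 0) +
      (if q = orbitMk π x then spinSign 1 else 1) * Real.exp (c * orbitSize q * spinSign 1) =
      (if q = orbitMk π x then Real.tanh (c * orbitSize q) else 1) *
        (2 * Real.cosh (c * orbitSize q)) := by
    intro q
    split_ifs
    · exact exp_sub_exp_spinSign _
    · simp only [one_mul, exp_add_exp_spinSign]
  simp_rw [h2]
  rw [Finset.prod_mul_distrib, Finset.prod_ite_eq' Finset.univ]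
  simp [orbitTanh, orbitWeight]

theorem invariantSum_spinSign_mul_of_ne (π : Equiv.Perm V) (c : ℝ) {x y : V}
    (hxy : orbitMk π x ≠ orbitMk π y) :
    invariantSum π c (fun s => spinSign (s x) * spinSign (s y)) =
      orbitWeight π c * (orbitTanh π c x * orbitTanh π c y) := by
  rw [invariantSum_eq]
  have h : ∀ u : PermOrbit π → Fin 2,
      spinSign ((u ∘ orbitMk π) x) * spinSign ((u ∘ orbitMk π) y) *
        ∏ q, Real.exp (c * orbitSize q * spinSign (u q)) =
      ∏ q, (if q = orbitMk π x then spinSign (u q) else 1) *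
        ((if q = orbitMk π y then spinSign (u q) else 1) *
        Real.exp (c * orbitSize q * spinSign (u q))) := by
    intro u
    rw [Finset.prod_mul_distrib, Finset.prod_mul_distrib, Finset.prod_ite_eq' Finset.univ,
      Finset.prod_ite_eq' Finset.univ]
    simp [mul_assoc]
  simp_rw [h]
  rw [sum_prod_orbit fun q a => (if q = orbitMk π x then spinSign a else 1) *
    ((if q = orbitMk π y then spinSign a else 1) * Real.exp (c * orbitSize q * spinSign a))]
  have h2 : ∀ q : PermOrbit π,
      (if q = orbitMk π x then spinSign 0 else 1) * ((if q = orbitMk π y then spinSign 0 else 1) *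
        Real.exp (c * orbitSize q * spinSign 0)) +
      (if q = orbitMk π x then spinSign 1 else 1) * ((if q = orbitMk π y then spinSign 1 else 1) *
        Real.exp (c * orbitSize q * spinSign 1)) =
      (if q = orbitMk π x then Real.tanh (c * orbitSize q) else 1) *
        ((if q = orbitMk π y then Real.tanh (c * orbitSize q) else 1) *
        (2 * Real.cosh (c * orbitSize q))) := by
    intro q
    split_ifs with h1 h2 h2
    · exact absurd (h1.symm.trans h2) hxy
    · simp only [one_mul, exp_sub_exp_spinSign]
    · simp only [one_mul, exp_sub_exp_spinSign]
    · simp only [one_mul, exp_add_exp_spinSign]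
  simp_rw [h2]
  rw [Finset.prod_mul_distrib, Finset.prod_mul_distrib, Finset.prod_ite_eq' Finset.univ,
    Finset.prod_ite_eq' Finset.univ]
  simp only [Finset.mem_univ, if_true, orbitTanh, orbitWeight]
  ring

/-- `1` if `x` and `y` belong to the same orbit of `π`, and the product of the two hyperbolic
tangents otherwise. -/
def orbitPairFactor (π : Equiv.Perm V) (c : ℝ) (x y : V) : ℝ :=
  if orbitMk π x = orbitMk π y then 1 else orbitTanh π c x * orbitTanh π c y

theorem invariantSum_spinSign_mul (π : Equiv.Perm V) (c : ℝ) (x y : V) :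
    invariantSum π c (fun s => spinSign (s x) * spinSign (s y)) =
      orbitWeight π c * orbitPairFactor π c x y := by
  by_cases hxy : orbitMk π x = orbitMk π y
  · rw [orbitPairFactor, if_pos hxy, mul_one, ← invariantSum_one, invariantSum_eq, invariantSum_eq]
    simp only [Function.comp, hxy, spinSign_mul_self]
  · rw [orbitPairFactor, if_neg hxy, invariantSum_spinSign_mul_of_ne π c hxy]

end Orbits

/-! ### The cycle weights as functions of the permutation -/

namespace IsFlow

variable {V : Type*} [Fintype V] {β : ℝ} {B : Set (Sym2 V × AddCircle β)}
  {Q : ℝ → Equiv.Perm V} {π : Equiv.Perm V}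

theorem cycleLength_cycleAt (hβ : 0 < β) (hQ : IsFlow B Q π) (x : V) :
    cycleLength B (cycleAt B x) = β * orbitSize (orbitMk π x) := by
  rw [hQ.cycleAt_eq hβ, hQ.cycleLength_flowSupport hβ, orbitSize_orbitMk]

theorem cycleWeight_eq (hβ : 0 < β) (hQ : IsFlow B Q π) (h : ℝ) :
    cycleWeight B h = orbitWeight π (h * β) := by
  let S : PermOrbit π → Set (V × AddCircle β) :=
    Quotient.lift (flowSupport β Q) fun x y hxy => (hQ.flowSupport_eq_iff x y).2 hxy
  have hS : ∀ x, S (orbitMk π x) = cycleAt B x := fun x => (hQ.cycleAt_eq hβ x).symm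
  have hinj : Function.Injective S := by
    intro p q hpq
    obtain ⟨x, rfl⟩ := orbitMk_surjective π p
    obtain ⟨y, rfl⟩ := orbitMk_surjective π q
    rw [hS, hS, hQ.cycleAt_eq_cycleAt_iff hβ] at hpq
    exact orbitMk_eq_iff.2 hpq
  have hrange : cycles B = Set.range S := by
    rw [hQ.cycles_eq hβ, ← (orbitMk_surjective π).range_comp]
    rfl
  rw [cycleWeight, hrange, finprod_mem_range hinj, finprod_eq_prod_of_fintype, orbitWeight]
  refine Finset.prod_congr rfl fun q _ => ?_
  obtain ⟨x, rfl⟩ := orbitMk_surjective π q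
  rw [hS, hQ.cycleLength_cycleAt hβ, mul_assoc]

theorem cycleTanh_eq (hβ : 0 < β) (hQ : IsFlow B Q π) (h : ℝ) (x : V) :
    cycleTanh B h x = orbitTanh π (h * β) x := by
  rw [cycleTanh, hQ.cycleLength_cycleAt hβ, orbitTanh, mul_assoc]

theorem pairFactor_eq (hβ : 0 < β) (hQ : IsFlow B Q π) (h : ℝ) (x y : V) :
    pairFactor B h x y = orbitPairFactor π (h * β) x y := by
  have hiff : cycleAt B x = cycleAt B y ↔ orbitMk π x = orbitMk π y := by
    rw [hQ.cycleAt_eq_cycleAt_iff hβ, orbitMk_eq_iff]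
  by_cases hxy : orbitMk π x = orbitMk π y
  · rw [pairFactor, orbitPairFactor, if_pos hxy, if_pos (hiff.2 hxy)]
  · rw [pairFactor, orbitPairFactor, if_neg hxy, if_neg (mt hiff.1 hxy), hQ.cycleTanh_eq hβ,
      hQ.cycleTanh_eq hβ]

end IsFlow

/-! ### Expansion of the Gibbs operator in products of transpositions -/

section Operators

variable {V : Type*} [Fintype V]

/-- The operator on `⨂ ℂ²` that permutes the tensor factors by `π`. The map `permOp` reverses
products. -/
def permOp (π : Equiv.Perm V) : SpinOp V :=
  Matrix.of fun s s' => if s' ∘ π = s then 1 else 0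

theorem permOp_one : permOp (1 : Equiv.Perm V) = 1 := by
  ext s s'
  simp [permOp, Matrix.one_apply, eq_comm]

variable [DecidableEq V]

theorem permOp_mul (π ρ : Equiv.Perm V) : permOp π * permOp ρ = permOp (ρ * π) := by
  ext s s'
  rw [Matrix.mul_apply, Finset.sum_eq_single (s' ∘ ρ)]
  · simp only [permOp, Matrix.of_apply, if_true, mul_one, Equiv.Perm.coe_mul, Function.comp_assoc]
    exact if_congr Iff.rfl rfl rfl
  · intro t _ ht
    simp [permOp, ht.symm]
  · simp

theorem permOp_mul_diagonal (π : Equiv.Perm V) (d : (V → Fin 2) → ℂ) :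
    permOp π * Matrix.diagonal d = Matrix.of fun s s' => if s' ∘ π = s then d s' else 0 := by
  ext s s'
  rw [Matrix.mul_diagonal]
  simp [permOp]

theorem commute_permOp_diagonal (π : Equiv.Perm V) {d : (V → Fin 2) → ℂ}
    (hd : ∀ s, d (s ∘ π) = d s) : Commute (permOp π) (Matrix.diagonal d) := by
  ext s s'
  rw [Matrix.mul_diagonal, Matrix.diagonal_mul]
  simp only [permOp, Matrix.of_apply]
  split_ifs with h
  · rw [← h, hd, one_mul, mul_one]
  · simp

theorem sum_spinMatrix (a a' b b' : Fin 2) :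
    ∑ i, spinMatrix i a a' * spinMatrix i b b' =
      (1 / 2 : ℂ) * (if a = b' ∧ b = a' then 1 else 0) -
        1 / 4 * (if a = a' ∧ b = b' then 1 else 0) := by
  rw [Fin.sum_univ_three]
  fin_cases a <;> fin_cases a' <;> fin_cases b <;> fin_cases b' <;>
    simp [spinMatrix] <;> ring_nf <;> simp <;> ring

/-- `S_x · S_y = T_{xy} / 2 - 1 / 4`, where `T_{xy}` is the transposition of two tensor factors. -/
theorem spinDot_eq {x y : V} (hxy : x ≠ y) :
    spinDot x y = (1 / 2 : ℂ) • permOp (Equiv.swap x y) - (1 / 4 : ℂ) • 1 := by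
  ext s s'
  have h1 : (s' ∘ Equiv.swap x y = s) ↔
      Function.update (Function.update s x (s' x)) y (s' y) = s' ∧ s x = s' y ∧ s y = s' x := by
    constructor
    · rintro rfl
      refine ⟨?_, by simp, by simp⟩
      funext z
      by_cases hzy : z = y
      · subst hzy; simp
      · by_cases hzx : z = x
        · subst hzx; simp [hxy]
        · simp [hzx, hzy, Equiv.swap_apply_of_ne_of_ne]
    · rintro ⟨h, hx, hy⟩
      funext z
      by_cases hzy : z = y
      · subst hzy; simp [hy]
      · by_cases hzx : z = x
        · subst hzx; simp [hx]
        · rw [Function.comp, Equiv.swap_apply_of_ne_of_ne hzx hzy, ← h]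
          simp [hzx, hzy]
  have h2 : (s = s') ↔
      Function.update (Function.update s x (s' x)) y (s' y) = s' ∧ s x = s' x ∧ s y = s' y := by
    constructor
    · rintro rfl
      simp
    · rintro ⟨h, hx, hy⟩
      rw [← h, ← hx, ← hy]
      simp
  simp only [spinDot, spinOp, Matrix.sum_apply, siteOp_mul_siteOp_apply hxy, Matrix.sub_apply,
    Matrix.smul_apply, permOp, Matrix.of_apply, Matrix.one_apply, smul_eq_mul]
  rw [if_congr h1 rfl rfl, if_congr h2 rfl rfl]
  by_cases h : Function.update (Function.update s x (s' x)) y (s' y) = s'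
  · simp only [h, if_true, true_and, sum_spinMatrix]
  · simp [h]

theorem edgeDot_eq {e : Sym2 V} (he : ¬ e.IsDiag) :
    edgeDot e = (1 / 2 : ℂ) • permOp (edgeSwap e) - (1 / 4 : ℂ) • 1 := by
  induction e using Sym2.ind with
  | _ a b => exact spinDot_eq (by simpa using he)

theorem spinOp_two (x : V) :
    spinOp 2 x = Matrix.diagonal fun s : V → Fin 2 => ((1 / 2 * spinSign (s x) : ℝ) : ℂ) := by
  ext s s'
  rw [spinOp, siteOp_apply, Matrix.diagonal_apply]
  by_cases h : s = s'
  · subst h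
    rw [Function.update_eq_self, if_pos rfl, if_pos rfl]
    generalize s x = a
    fin_cases a <;> simp [spinMatrix, spinSign]
  · rw [if_neg h]
    split_ifs with h'
    · have hx : s x ≠ s' x := by
        intro hx
        rw [← hx, Function.update_eq_self] at h'
        exact h h'
      revert hx
      generalize s x = a
      generalize s' x = b
      fin_cases a <;> fin_cases b <;> simp [spinMatrix]
    · rfl

variable (G : SimpleGraph V) [DecidableRel G.Adj]

/-- The sum of the transpositions over all edges. -/
def swapSum : SpinOp V := ∑ e : G.edgeSet, permOp (edgeSwap e.1)

theorem swapSum_pow (k : ℕ) :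
    swapSum G ^ k = ∑ e : Fin k → G.edgeSet, permOp (bridgePerm e) := by
  induction k with
  | zero => simp [bridgePerm, orderedProd, permOp_one]
  | succ k ih =>
    rw [pow_succ, ih, swapSum, Finset.sum_mul_sum, Finset.sum_comm,
      ← (Fin.snocEquiv fun _ : Fin (k + 1) => ↥G.edgeSet).sum_comp, Fintype.sum_prod_type]
    refine Finset.sum_congr rfl fun a _ => Finset.sum_congr rfl fun e _ => ?_
    rw [permOp_mul]
    simp [bridgePerm, orderedProd, Fin.snocEquiv]

theorem sum_edgeDot :
    ∑ e ∈ G.edgeFinset, edgeDot e =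
      (1 / 2 : ℂ) • swapSum G - (1 / 4 * G.edgeFinset.card : ℂ) • 1 := by
  have h : ∑ e ∈ G.edgeFinset, edgeDot e =
      ∑ e ∈ G.edgeFinset, ((1 / 2 : ℂ) • permOp (edgeSwap e) - (1 / 4 : ℂ) • 1) :=
    Finset.sum_congr rfl fun e he =>
      edgeDot_eq (G.not_isDiag_of_mem_edgeSet (SimpleGraph.mem_edgeFinset.1 he))
  rw [h, Finset.sum_sub_distrib, ← Finset.smul_sum, Finset.sum_const, swapSum,
    Finset.sum_subtype G.edgeFinset (p := fun e => e ∈ G.edgeSet)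
      fun e => SimpleGraph.mem_edgeFinset,
    ← Nat.cast_smul_eq_nsmul ℂ, smul_smul, mul_comm (1 / 4 : ℂ)]

theorem smul_hamiltonian_eq (β h : ℝ) :
    -((2 * β : ℝ) : ℂ) • hamiltonian G h = (β : ℂ) • swapSum G +
      Matrix.diagonal fun s : V → Fin 2 =>
        ((h * β * ∑ x, spinSign (s x) - β / 2 * G.edgeFinset.card : ℝ) : ℂ) := by
  have h2 : ∑ x : V, spinOp 2 x =
      Matrix.diagonal fun s : V → Fin 2 => ((1 / 2 * ∑ x, spinSign (s x) : ℝ) : ℂ) := by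
    ext s s'
    simp only [spinOp_two, Matrix.sum_apply, Matrix.diagonal_apply]
    split_ifs
    · rw [← Complex.ofReal_sum, Finset.mul_sum]
    · simp
  rw [hamiltonian, sum_edgeDot, h2]
  ext s s'
  simp only [Matrix.smul_apply, Matrix.sub_apply, Matrix.neg_apply, Matrix.add_apply,
    Matrix.diagonal_apply, Matrix.one_apply, smul_eq_mul]
  split_ifs <;> push_cast <;> ring

theorem commute_swapSum_diagonal {d : (V → Fin 2) → ℂ}
    (hd : ∀ (π : Equiv.Perm V) s, d (s ∘ π) = d s) :
    Commute (swapSum G) (Matrix.diagonal d) :=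
  Finset.sum_induction _ (fun M : SpinOp V => Commute M (Matrix.diagonal d))
    (fun _ _ h1 h2 => h1.add_left h2) (Commute.zero_left _)
    fun _ _ => commute_permOp_diagonal _ (hd _)

/-- The transpositions commute with the magnetic field, so that the Gibbs operator factorizes. -/
theorem exp_smul_hamiltonian (β h : ℝ) :
    NormedSpace.exp (-((2 * β : ℝ) : ℂ) • hamiltonian G h) =
      NormedSpace.exp ((β : ℂ) • swapSum G) * Matrix.diagonal fun s : V → Fin 2 =>
        ((Real.exp (-(β / 2 * G.edgeFinset.card)) *
          Real.exp (h * β * ∑ x, spinSign (s x)) : ℝ) : ℂ) := by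
  rw [smul_hamiltonian_eq, Matrix.exp_add_of_commute, Matrix.exp_diagonal]
  · congr 2
    funext s
    rw [Pi.coe_exp, ← Complex.exp_eq_exp_ℂ, ← Real.exp_add, Complex.ofReal_exp]
    congr 2
    ring
  · refine (commute_swapSum_diagonal G fun π s => ?_).smul_left _
    simp only [Function.comp]
    rw [Equiv.sum_comp π fun x => spinSign (s x)]

theorem trace_diagonal_permOp (π : Equiv.Perm V) (c E : ℝ) (a : (V → Fin 2) → ℝ) :
    (Matrix.diagonal (fun s => (a s : ℂ)) * (permOp π *
      Matrix.diagonal fun s : V → Fin 2 =>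
        ((E * Real.exp (c * ∑ x, spinSign (s x)) : ℝ) : ℂ))).trace =
      ((E * invariantSum π c a : ℝ) : ℂ) := by
  rw [permOp_mul_diagonal, Matrix.trace, invariantSum, Finset.mul_sum, Complex.ofReal_sum]
  refine Finset.sum_congr rfl fun s _ => ?_
  rw [Matrix.diag_apply, Matrix.diagonal_mul, Matrix.of_apply]
  split_ifs
  · push_cast; ring
  · simp

/-- The expansion of a Gibbs trace, for an observable that is diagonal in the basis of the spin
configurations, as a sum over finite sequences of edges. -/
theorem hasSum_gibbsTrace (β h : ℝ) (a : (V → Fin 2) → ℝ) :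
    HasSum (fun k : ℕ => ((Real.exp (-(β / 2 * G.edgeFinset.card)) * (β ^ k / k.factorial *
        ∑ e : Fin k → G.edgeSet, invariantSum (bridgePerm e) (h * β) a) : ℝ) : ℂ))
      (gibbsTrace G (2 * β) h (Matrix.diagonal fun s => (a s : ℂ))) := by
  let : NormedRing (SpinOp V) := Matrix.linftyOpNormedRing
  let : NormedAlgebra ℂ (SpinOp V) := Matrix.linftyOpNormedAlgebra
  have hexp : HasSum (fun k : ℕ => ((k.factorial : ℂ)⁻¹) • ((β : ℂ) • swapSum G) ^ k)
      (NormedSpace.exp ((β : ℂ) • swapSum G)) := NormedSpace.exp_series_hasSum_exp' _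
  have hmap := ((hexp.mul_right (Matrix.diagonal fun s : V → Fin 2 =>
    ((Real.exp (-(β / 2 * G.edgeFinset.card)) *
      Real.exp (h * β * ∑ x, spinSign (s x)) : ℝ) : ℂ))).mul_left
    (Matrix.diagonal fun s => (a s : ℂ))).map (Matrix.traceAddMonoidHom (V → Fin 2) ℂ)
      (Continuous.matrix_trace continuous_id)
  rw [gibbsTrace, exp_smul_hamiltonian]
  convert! hmap using 1
  funext k
  simp only [Function.comp, Matrix.traceAddMonoidHom_apply]
  rw [smul_pow, swapSum_pow, smul_smul, smul_mul_assoc, mul_smul_comm, Matrix.trace_smul,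
    Finset.sum_mul, Finset.mul_sum Finset.univ _ (Matrix.diagonal _),
    Matrix.trace_sum]
  simp only [trace_diagonal_permOp]
  rw [← Complex.ofReal_sum, ← Finset.mul_sum, smul_eq_mul]
  push_cast
  ring

end Operators

/-! ### Integration against the law of the Poisson edge process -/

section Law

theorem timeSimplex_eq (k : ℕ) (β : ℝ) :
    timeSimplex k β = (⋂ i, ⋂ j, {t : Fin k → ℝ | i < j → t i < t j}) ∩
      ⋂ i, {t : Fin k → ℝ | t i ∈ Set.Ioo 0 β} := by
  ext t
  simp [timeSimplex, StrictMono]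

theorem measurableSet_timeSimplex (k : ℕ) (β : ℝ) : MeasurableSet (timeSimplex k β) := by
  rw [timeSimplex_eq]
  refine (MeasurableSet.iInter fun i => MeasurableSet.iInter fun j => ?_).inter
    (MeasurableSet.iInter fun i => measurable_pi_apply i measurableSet_Ioo)
  by_cases hij : i < j
  · simpa [hij] using measurableSet_lt (measurable_pi_apply i) (measurable_pi_apply j)
  · simp [hij]

theorem volume_timeSimplex_ne_zero (k : ℕ) {β : ℝ} (hβ : 0 < β) :
    volume (timeSimplex k β) ≠ 0 := by
  have hopen : IsOpen (timeSimplex k β) := by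
    rw [timeSimplex_eq]
    refine (isOpen_iInter_of_finite fun i => isOpen_iInter_of_finite fun j => ?_).inter
      (isOpen_iInter_of_finite fun i => isOpen_Ioo.preimage (continuous_apply i))
    by_cases hij : i < j
    · simpa [hij] using isOpen_lt (continuous_apply i) (continuous_apply j)
    · simp [hij]
  have hne : (timeSimplex k β).Nonempty := by
    refine ⟨fun i => β * ((i + 1 : ℝ) / (k + 1)), fun i j hij => ?_, fun i => ⟨by positivity, ?_⟩⟩
    · have : (i : ℝ) < j := by exact_mod_cast hij
      dsimp only
      gcongr
    · have : (i : ℝ) < k := by exact_mod_cast i.2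
      exact mul_lt_of_lt_one_right hβ ((div_lt_one (by positivity)).2 (by linarith))
  exact (hopen.measure_pos volume hne).ne'

theorem volume_timeSimplex_ne_top (k : ℕ) (β : ℝ) : volume (timeSimplex k β) ≠ ⊤ := by
  have hsub : timeSimplex k β ⊆ Set.pi Set.univ fun _ => Set.Ioo 0 β := fun t ht i _ => ht.2 i
  refine ne_top_of_le_ne_top ?_ (measure_mono hsub)
  rw [Real.volume_pi_Ioo]
  exact ENNReal.prod_ne_top fun i _ => ENNReal.ofReal_ne_top

variable {V : Type*} (G : SimpleGraph V) {β : ℝ}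

theorem measurable_zipBridges (k : ℕ) :
    Measurable fun (p : (Fin k → G.edgeSet) × (Fin k → ℝ)) i => (p.1 i, p.2 i) := by
  refine measurable_pi_lambda _ fun i => ?_
  exact ((measurable_pi_apply i).comp measurable_fst).prodMk
    ((measurable_pi_apply i).comp measurable_snd)

theorem measurable_edges (k : ℕ) :
    Measurable fun (p : Fin k → G.edgeSet × ℝ) i => (p i).1 :=
  measurable_pi_lambda _ fun i => measurable_fst.comp (measurable_pi_apply i)

theorem measurable_times (k : ℕ) :
    Measurable fun (p : Fin k → G.edgeSet × ℝ) i => (p i).2 :=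
  measurable_pi_lambda _ fun i => measurable_snd.comp (measurable_pi_apply i)

instance isProbabilityMeasure_timeLaw (k : ℕ) [hβ : Fact (0 < β)] :
    IsProbabilityMeasure (cond (volume : Measure (Fin k → ℝ)) (timeSimplex k β)) :=
  cond_isProbabilityMeasure_of_finite (volume_timeSimplex_ne_zero k hβ.out)
    (volume_timeSimplex_ne_top k β)

theorem ae_bridgeLaw_mem_timeSimplex (k : ℕ) :
    ∀ᵐ p ∂bridgeLaw G β k, (fun i => (p i).2) ∈ timeSimplex k β := by
  rw [bridgeLaw, ae_map_iff (measurable_zipBridges G k).aemeasurable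
    (measurable_times G k (measurableSet_timeSimplex k β))]
  exact Measure.quasiMeasurePreserving_snd.ae (ae_cond_mem (measurableSet_timeSimplex k β))

theorem map_edges_bridgeLaw (hβ : 0 < β) (k : ℕ) :
    (bridgeLaw G β k).map (fun p i => (p i).1) = uniformOn Set.univ := by
  have : Fact (0 < β) := ⟨hβ⟩
  rw [bridgeLaw, Measure.map_map (measurable_edges G k) (measurable_zipBridges G k)]
  change Measure.map Prod.fst _ = _
  rw [Measure.map_fst_prod, measure_univ, one_smul]

theorem bridgeLaw_univ_le_one (hβ : 0 < β) (k : ℕ) : bridgeLaw G β k Set.univ ≤ 1 := by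
  have : Fact (0 < β) := ⟨hβ⟩
  rw [bridgeLaw, Measure.map_apply (measurable_zipBridges G k) MeasurableSet.univ,
    Set.preimage_univ, ← Set.univ_prod_univ, Measure.prod_prod,
    measure_univ (μ := cond volume (timeSimplex k β)), mul_one]
  exact prob_le_one

theorem measurable_sigmaMk (k : ℕ) :
    Measurable fun p : Fin k → G.edgeSet × ℝ => (⟨k, p⟩ : BridgeSeq G) :=
  Measurable.of_le_map (iInf_le _ k)

theorem measurableSet_bridgeSeq_iff {s : Set (BridgeSeq G)} :
    MeasurableSet s ↔ ∀ k, MeasurableSet {p : Fin k → G.edgeSet × ℝ | (⟨k, p⟩ : BridgeSeq G) ∈ s} :=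
  MeasurableSpace.measurableSet_iInf

variable [Fintype V] [DecidableRel G.Adj]

theorem poissonEdgeLaw_univ_le_one (hβ : 0 < β) : poissonEdgeLaw G β Set.univ ≤ 1 := by
  rw [poissonEdgeLaw, Measure.sum_apply _ MeasurableSet.univ]
  calc _ ≤ ∑' k, poissonMeasure (β * G.edgeFinset.card).toNNReal {k} := by
        refine ENNReal.tsum_le_tsum fun k => ?_
        rw [Measure.smul_apply, Measure.map_apply (measurable_sigmaMk G k) MeasurableSet.univ,
          Set.preimage_univ, smul_eq_mul]
        exact mul_le_of_le_one_right' (bridgeLaw_univ_le_one G hβ k)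
    _ = 1 := by
        rw [← measure_univ (μ := poissonMeasure (β * G.edgeFinset.card).toNNReal),
          ← Set.iUnion_of_singleton,
          measure_iUnion (fun i j hij => by simpa using hij) fun i => measurableSet_singleton i]

theorem isFiniteMeasure_poissonEdgeLaw (hβ : 0 < β) : IsFiniteMeasure (poissonEdgeLaw G β) :=
  ⟨(poissonEdgeLaw_univ_le_one G hβ).trans_lt ENNReal.one_lt_top⟩

theorem ae_poissonEdgeLaw_mem_timeSimplex :
    ∀ᵐ ω ∂poissonEdgeLaw G β, (fun i => (ω.2 i).2) ∈ timeSimplex ω.1 β := by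
  rw [poissonEdgeLaw, Measure.ae_sum_iff]
  · intro k
    refine Measure.ae_smul_measure ?_ _
    refine (ae_map_iff (measurable_sigmaMk G k).aemeasurable ?_).2
      (ae_bridgeLaw_mem_timeSimplex G k)
    exact (measurableSet_bridgeSeq_iff G).2 fun k =>
      measurable_times G k (measurableSet_timeSimplex k β)

theorem integral_bridgeLaw (hβ : 0 < β) (k : ℕ) (f : (Fin k → G.edgeSet) → ℝ) :
    ∫ p, f (fun i => (p i).1) ∂bridgeLaw G β k =
      ((G.edgeFinset.card : ℝ) ^ k)⁻¹ * ∑ e, f e := by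
  have hf : Measurable f := measurable_of_finite f
  have h := integral_map (measurable_edges G k).aemeasurable
    (hf.aestronglyMeasurable (μ := (bridgeLaw G β k).map (fun p i => (p i).1)))
  rw [← h, map_edges_bridgeLaw G hβ, integral_fintype Integrable.of_finite, Finset.mul_sum]
  refine Finset.sum_congr rfl fun e _ => ?_
  rw [measureReal_def, uniformOn_univ, Measure.count_singleton, smul_eq_mul]
  congr 1
  rw [Fintype.card_fun, Fintype.card_fin, ← SimpleGraph.edgeFinset_card]
  simp

variable [DecidableEq V]

/-- The permutation of the vertices that a realization of the Poisson edge process produces. -/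
def realizationPerm {G : SimpleGraph V} (ω : BridgeSeq G) : Equiv.Perm V :=
  bridgePerm fun i => (ω.2 i).1

theorem measurable_realizationPerm {α : Type*} [MeasurableSpace α] (g : Equiv.Perm V → α) :
    Measurable fun ω : BridgeSeq G => g (realizationPerm ω) := by
  intro s _
  refine (measurableSet_bridgeSeq_iff G).2 fun k => ?_
  exact measurable_edges G k
    ((Set.toFinite {e : Fin k → G.edgeSet | g (bridgePerm e) ∈ s}).measurableSet)

theorem integrable_realizationPerm (hβ : 0 < β) (g : Equiv.Perm V → ℝ) :
    Integrable (fun ω => g (realizationPerm ω)) (poissonEdgeLaw G β) := by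
  have := isFiniteMeasure_poissonEdgeLaw G hβ
  obtain ⟨C, hC⟩ := (Set.finite_range fun π => ‖g π‖).bddAbove
  exact Integrable.of_bound (measurable_realizationPerm G g).aestronglyMeasurable C
    (Eventually.of_forall fun ω => hC ⟨_, rfl⟩)

/-- The expectation of a function of the permutation, expanded in the number of bridges. -/
theorem hasSum_integral_realizationPerm (hβ : 0 < β) (g : Equiv.Perm V → ℝ) :
    HasSum (fun k : ℕ => Real.exp (-(β * G.edgeFinset.card)) * (β ^ k / k.factorial *
        ∑ e : Fin k → G.edgeSet, g (bridgePerm e)))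
      (∫ ω, g (realizationPerm ω) ∂poissonEdgeLaw G β) := by
  have h := hasSum_integral_measure (integrable_realizationPerm G hβ g)
  convert! h using 1
  funext k
  rw [integral_smul_measure, integral_map (measurable_sigmaMk G k).aemeasurable
    (measurable_realizationPerm G g).aestronglyMeasurable]
  have h2 := integral_bridgeLaw G hβ k fun e => g (bridgePerm e)
  rw [show (fun p : Fin k → G.edgeSet × ℝ => g (realizationPerm (⟨k, p⟩ : BridgeSeq G))) =
    fun p => g (bridgePerm fun i => (p i).1) from rfl, h2, poissonMeasure_singleton,
    ENNReal.toReal_ofReal (by positivity), Real.coe_toNNReal _ (by positivity), smul_eq_mul]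
  -- Without edges the law of `k ≥ 1` bridges is the zero measure, and there is nothing to sum over.
  rcases Nat.eq_zero_or_pos G.edgeFinset.card with hE | hE
  · rcases Nat.eq_zero_or_pos k with rfl | hk
    · simp
    · have : IsEmpty G.edgeSet := by
        rw [← Fintype.card_eq_zero_iff, ← SimpleGraph.edgeFinset_card, hE]
      have : IsEmpty (Fin k → G.edgeSet) := ⟨fun e => this.elim (e ⟨0, hk⟩)⟩
      simp
  · field_simp
    rw [mul_pow]
    ring

end Law

/-! ### Gibbs traces as expectations over the Poisson edge process -/

section Representation

variable {V : Type*} [Fintype V] [DecidableEq V] (G : SimpleGraph V) [DecidableRel G.Adj] {β : ℝ}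

/-- The Gibbs trace and the expectation have the same expansion in the number of bridges. -/
theorem gibbsTrace_diagonal (hβ : 0 < β) (h : ℝ) (a : (V → Fin 2) → ℝ) :
    gibbsTrace G (2 * β) h (Matrix.diagonal fun s => (a s : ℂ)) =
      ((Real.exp (β / 2 * G.edgeFinset.card) *
        ∫ ω, invariantSum (realizationPerm ω) (h * β) a ∂poissonEdgeLaw G β : ℝ) : ℂ) := by
  refine (hasSum_gibbsTrace G β h a).unique ?_
  have := (hasSum_integral_realizationPerm G hβ fun π => invariantSum π (h * β) a).mul_left
    (Real.exp (β / 2 * G.edgeFinset.card))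
  convert! Complex.hasSum_ofReal.2 this using 1
  funext k
  rw [← mul_assoc (Real.exp (β / 2 * _)), ← Real.exp_add]
  congr 4
  ring

theorem partitionFunction_eq (hβ : 0 < β) (h : ℝ) :
    partitionFunction G (2 * β) h = ((Real.exp (β / 2 * G.edgeFinset.card) *
      ∫ ω, orbitWeight (realizationPerm ω) (h * β) ∂poissonEdgeLaw G β : ℝ) : ℂ) := by
  have := gibbsTrace_diagonal G hβ h fun _ => 1
  simp only [invariantSum_one] at this
  rw [← this, gibbsTrace, Complex.ofReal_one, Matrix.diagonal_one, one_mul, partitionFunction]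

theorem gibbsTrace_spinOp (hβ : 0 < β) (h : ℝ) (x : V) :
    gibbsTrace G (2 * β) h (spinOp 2 x) = ((1 / 2 * Real.exp (β / 2 * G.edgeFinset.card) *
      ∫ ω, orbitTanh (realizationPerm ω) (h * β) x * orbitWeight (realizationPerm ω) (h * β)
        ∂poissonEdgeLaw G β : ℝ) : ℂ) := by
  rw [spinOp_two, gibbsTrace_diagonal G hβ]
  simp only [invariantSum_const_mul, invariantSum_spinSign]
  rw [integral_const_mul]
  congr 1
  ring

theorem gibbsTrace_spinOp_mul (hβ : 0 < β) (h : ℝ) (x y : V) :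
    gibbsTrace G (2 * β) h (spinOp 2 x * spinOp 2 y) =
      ((1 / 4 * Real.exp (β / 2 * G.edgeFinset.card) *
        ∫ ω, orbitWeight (realizationPerm ω) (h * β) *
          orbitPairFactor (realizationPerm ω) (h * β) x y ∂poissonEdgeLaw G β : ℝ) : ℂ) := by
  have hdiag : (spinOp 2 x * spinOp 2 y : SpinOp V) =
      Matrix.diagonal fun s => ((1 / 4 * (spinSign (s x) * spinSign (s y)) : ℝ) : ℂ) := by
    rw [spinOp_two, spinOp_two, Matrix.diagonal_mul_diagonal]
    congr 1
    funext s
    rw [← Complex.ofReal_mul]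
    congr 1
    ring
  rw [hdiag, gibbsTrace_diagonal G hβ]
  simp only [invariantSum_const_mul, invariantSum_spinSign_mul]
  rw [integral_const_mul]
  congr 1
  ring

theorem ae_isFlow (hβ : 0 < β) :
    ∀ᵐ ω ∂poissonEdgeLaw G β, ∃ Q, IsFlow (bridges β ω) Q (realizationPerm ω) := by
  filter_upwards [ae_poissonEdgeLaw_mem_timeSimplex G] with ω hω
  exact ⟨_, isFlow_bridges hβ ω hω⟩

theorem cycleWeight_ae_eq (hβ : 0 < β) (h : ℝ) :
    (fun ω => cycleWeight (bridges β ω) h) =ᵐ[poissonEdgeLaw G β]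
      fun ω => orbitWeight (realizationPerm ω) (h * β) := by
  filter_upwards [ae_isFlow G hβ] with ω ⟨Q, hQ⟩
  exact hQ.cycleWeight_eq hβ h

theorem cycleTanh_ae_eq (hβ : 0 < β) (h : ℝ) (x : V) :
    (fun ω => cycleTanh (bridges β ω) h x) =ᵐ[poissonEdgeLaw G β]
      fun ω => orbitTanh (realizationPerm ω) (h * β) x := by
  filter_upwards [ae_isFlow G hβ] with ω ⟨Q, hQ⟩
  exact hQ.cycleTanh_eq hβ h x

theorem pairFactor_ae_eq (hβ : 0 < β) (h : ℝ) (x y : V) :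
    (fun ω => pairFactor (bridges β ω) h x y) =ᵐ[poissonEdgeLaw G β]
      fun ω => orbitPairFactor (realizationPerm ω) (h * β) x y := by
  filter_upwards [ae_isFlow G hβ] with ω ⟨Q, hQ⟩
  exact hQ.pairFactor_eq hβ h x y

theorem integral_orbitWeight_pos (hβ : 0 < β) (c : ℝ) :
    0 < ∫ ω, orbitWeight (realizationPerm ω) c ∂poissonEdgeLaw G β := by
  have hsum := hasSum_integral_realizationPerm G hβ fun π => orbitWeight π c
  have hpos : ∀ π : Equiv.Perm V, 0 < orbitWeight π c := fun π => orbitWeight_pos π c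
  -- The contribution of the realizations without bridges is already positive.
  refine lt_of_lt_of_le ?_ (le_hasSum hsum 0 fun k _ => ?_)
  · have : 0 < ∑ e : Fin 0 → G.edgeSet, orbitWeight (bridgePerm e) c :=
      Finset.sum_pos (fun e _ => hpos _) Finset.univ_nonempty
    positivity
  · have : 0 ≤ ∑ e : Fin k → G.edgeSet, orbitWeight (bridgePerm e) c :=
      Finset.sum_nonneg fun e _ => (hpos _).le
    positivity

theorem lintegral_cycleWeight (hβ : 0 < β) (h : ℝ) :
    ∫⁻ ω, ENNReal.ofReal (cycleWeight (bridges β ω) h) ∂poissonEdgeLaw G β =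
      ENNReal.ofReal (∫ ω, orbitWeight (realizationPerm ω) (h * β) ∂poissonEdgeLaw G β) := by
  rw [ofReal_integral_eq_lintegral_ofReal
    (integrable_realizationPerm G hβ fun π => orbitWeight π (h * β))
    (Eventually.of_forall fun ω => (orbitWeight_pos _ _).le)]
  refine lintegral_congr_ae ?_
  filter_upwards [cycleWeight_ae_eq G hβ h] with ω hω
  rw [hω]

theorem isProbabilityMeasure_cycleMeasure (hβ : 0 < β) (h : ℝ) :
    IsProbabilityMeasure (cycleMeasure G β h) := by
  constructor
  rw [cycleMeasure, Measure.smul_apply, withDensity_apply _ MeasurableSet.univ,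
    Measure.restrict_univ, smul_eq_mul, lintegral_cycleWeight G hβ]
  exact ENNReal.inv_mul_cancel
    (ENNReal.ofReal_pos.2 (integral_orbitWeight_pos G hβ _)).ne' ENNReal.ofReal_ne_top

/-- In zero field the pair factor is the indicator function of the event that the two vertices
belong to the same cycle. -/
theorem cycleMeasure_real_cycleAt_eq (hβ : 0 < β) (x y : V) :
    (cycleMeasure G β 0).real {ω | cycleAt (bridges β ω) x = cycleAt (bridges β ω) y} =
      (∫ ω, orbitWeight (realizationPerm ω) (0 * β) ∂poissonEdgeLaw G β)⁻¹ *
        ∫ ω, orbitWeight (realizationPerm ω) (0 * β) *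
          orbitPairFactor (realizationPerm ω) (0 * β) x y ∂poissonEdgeLaw G β := by
  have := isFiniteMeasure_poissonEdgeLaw G hβ
  let S : Set (BridgeSeq G) :=
    {ω | orbitMk (realizationPerm ω) x = orbitMk (realizationPerm ω) y}
  have hS : MeasurableSet S :=
    measurable_realizationPerm G (fun π => orbitMk π x = orbitMk π y) (measurableSet_setOfPred.2
      measurable_id)
  have hSae : {ω | cycleAt (bridges β ω) x = cycleAt (bridges β ω) y}
      =ᵐ[poissonEdgeLaw G β] S := by
    filter_upwards [ae_isFlow G hβ] with ω ⟨Q, hQ⟩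
    exact propext ((hQ.cycleAt_eq_cycleAt_iff hβ x y).trans orbitMk_eq_iff.symm)
  have hpair : ∀ π : Equiv.Perm V, orbitPairFactor π (0 * β) x y =
      if orbitMk π x = orbitMk π y then 1 else 0 := by
    intro π
    simp [orbitPairFactor, orbitTanh]
  have hnonneg : ∀ π : Equiv.Perm V,
      0 ≤ orbitWeight π (0 * β) * orbitPairFactor π (0 * β) x y := by
    intro π
    rw [hpair]
    exact mul_nonneg (orbitWeight_pos _ _).le (by split_ifs <;> norm_num)
  have hlint : ∫⁻ ω in S, ENNReal.ofReal (cycleWeight (bridges β ω) 0) ∂poissonEdgeLaw G β =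
      ENNReal.ofReal (∫ ω, orbitWeight (realizationPerm ω) (0 * β) *
        orbitPairFactor (realizationPerm ω) (0 * β) x y ∂poissonEdgeLaw G β) := by
    rw [ofReal_integral_eq_lintegral_ofReal (integrable_realizationPerm G hβ fun π =>
      orbitWeight π (0 * β) * orbitPairFactor π (0 * β) x y)
      (Eventually.of_forall fun ω => hnonneg _), ← lintegral_indicator hS]
    refine lintegral_congr_ae ?_
    filter_upwards [cycleWeight_ae_eq G hβ 0] with ω hω
    rw [hpair]
    by_cases hxy : orbitMk (realizationPerm ω) x = orbitMk (realizationPerm ω) y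
    · rw [Set.indicator_of_mem (show ω ∈ S from hxy), if_pos hxy, mul_one, hω]
    · rw [Set.indicator_of_notMem (show ω ∉ S from hxy), if_neg hxy, mul_zero, ENNReal.ofReal_zero]
  rw [cycleMeasure, measureReal_def, Measure.smul_apply, withDensity_apply',
    setLIntegral_congr hSae, hlint, lintegral_cycleWeight G hβ, smul_eq_mul, ENNReal.toReal_mul,
    ENNReal.toReal_inv, ENNReal.toReal_ofReal (integral_orbitWeight_pos G hβ _).le,
    ENNReal.toReal_ofReal (integral_nonneg fun ω => hnonneg _)]

end Representation

end HeisenbergCycles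

end

open HeisenbergCycles in
theorem mainTheorem3 {V : Type*} [Fintype V] [DecidableEq V] (G : SimpleGraph V)
    [DecidableRel G.Adj] (β : ℝ) (hβ : 0 < β) (h : ℝ) :
    (Integrable (fun ω => cycleWeight (bridges β ω) h) (poissonEdgeLaw G β) ∧
      partitionFunction G (2 * β) h =
        ((Real.exp (β / 2 * G.edgeFinset.card) *
          ∫ ω, cycleWeight (bridges β ω) h ∂poissonEdgeLaw G β : ℝ) : ℂ)) ∧
    (∀ x : V,
      Integrable (fun ω => cycleTanh (bridges β ω) h x * cycleWeight (bridges β ω) h)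
        (poissonEdgeLaw G β) ∧
      gibbsTrace G (2 * β) h (spinOp 2 x) =
        ((1 / 2 * Real.exp (β / 2 * G.edgeFinset.card) *
          ∫ ω, cycleTanh (bridges β ω) h x * cycleWeight (bridges β ω) h
            ∂poissonEdgeLaw G β : ℝ) : ℂ)) ∧
    (∀ x y : V,
      Integrable (fun ω => cycleWeight (bridges β ω) h * pairFactor (bridges β ω) h x y)
        (poissonEdgeLaw G β) ∧
      gibbsTrace G (2 * β) h (spinOp 2 x * spinOp 2 y) =
        ((1 / 4 * Real.exp (β / 2 * G.edgeFinset.card) *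
          ∫ ω, cycleWeight (bridges β ω) h * pairFactor (bridges β ω) h x y
            ∂poissonEdgeLaw G β : ℝ) : ℂ)) ∧
    IsProbabilityMeasure (cycleMeasure G β 0) ∧
    (∀ x y : V, gibbsState G (2 * β) 0 (spinOp 2 x * spinOp 2 y) =
      ((1 / 4 * (cycleMeasure G β 0).real
        {ω | cycleAt (bridges β ω) x = cycleAt (bridges β ω) y} : ℝ) : ℂ)) := by
  have hW := cycleWeight_ae_eq G hβ h
  refine ⟨⟨?_, ?_⟩, fun x => ⟨?_, ?_⟩, fun x y => ⟨?_, ?_⟩,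
    isProbabilityMeasure_cycleMeasure G hβ 0, fun x y => ?_⟩
  · exact (integrable_realizationPerm G hβ fun π => orbitWeight π (h * β)).congr hW.symm
  · rw [partitionFunction_eq G hβ, integral_congr_ae hW]
  · exact (integrable_realizationPerm G hβ fun π =>
      orbitTanh π (h * β) x * orbitWeight π (h * β)).congr
        ((cycleTanh_ae_eq G hβ h x).mul hW).symm
  · rw [gibbsTrace_spinOp G hβ]
    congr 2
    exact integral_congr_ae ((cycleTanh_ae_eq G hβ h x).mul hW).symm
  · exact (integrable_realizationPerm G hβ fun π =>
      orbitWeight π (h * β) * orbitPairFactor π (h * β) x y).congr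
        (hW.mul (pairFactor_ae_eq G hβ h x y)).symm
  · rw [gibbsTrace_spinOp_mul G hβ]
    congr 2
    exact integral_congr_ae (hW.mul (pairFactor_ae_eq G hβ h x y)).symm
  · rw [gibbsState, partitionFunction_eq G hβ, gibbsTrace_spinOp_mul G hβ,
      cycleMeasure_real_cycleAt_eq G hβ, ← Complex.ofReal_inv, ← Complex.ofReal_mul]
    congr 1
    have := integral_orbitWeight_pos G hβ (0 * β)
    field_simp
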